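/- Let $k$ be a field of characteristic $0$ with algebraic closure $k^{alg}$ and $\mathrm{Gal}_k=\mathrm{Aut}(k^{alg}/k)$, and let $X$ be a smooth, separated, geometrically connected $k$-scheme of finite type (for example a smooth geometrically connected quasi-projective one). *Covers.* Let $\mathcal M$ be a family of connected finite Galois étale covers $X_\mu\to X$ such that every connected finite Galois étale cover of $X$ is dominated by some $X_\mu$ (for example, a family that represents all of them up to isomorphism). Let $k^\mu$ be the field of global functions on $X_\mu$ that are algebraic over $k$. For a $k$-embedding $\alpha:k^\mu\to k^{alg}$ (equivalently, for a zero $\alpha$ in $k^{alg}$ of the minimal polynomial of a generator of $k^\mu$ over $k$) let $X_{\mu,\alpha}=X_\mu\times_{k^\mu,\alpha}k^{alg}$, with its covering map $\mu_\alpha:X_{\mu,\alpha}\to X$. For $\sigma\in\mathrm{Gal}_k$ put $\sigma(\alpha)=\sigma\circ\alpha$. An intermediate morphism is a morphism $f:X_{\mu,\alpha}\to X_{\nu,\beta}$ over $k^{alg}$ and over $X$; conjugation by $\sigma$ gives an intermediate morphism $f^\sigma:X_{\mu,\sigma(\alpha)}\to X_{\nu,\sigma(\beta)}$. Let $\mathrm{GDeck}(X_{\mu,\alpha}/X)$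 be the group of automorphisms of $X_{\mu,\alpha}$ over $k^{alg}$ and over $X$. *Distinguished morphisms.* Fix a projective system of distinguished morphisms: for each pair $(\mu,\alpha)$, $(\nu,\beta)$ for which some intermediate morphism $X_{\mu,\alpha}\to X_{\nu,\beta}$ exists, one of these, written $(\nu_\beta^{-1}\mu_\alpha)$, such that identities and composites of distinguished morphisms are distinguished. Let $G^\sharp\le\mathrm{Gal}_k$ be the subgroup of the $\sigma$ with $(\nu_\beta^{-1}\mu_\alpha)^\sigma=(\nu_{\sigma(\beta)}^{-1}\mu_{\sigma(\alpha)})$ for all distinguished morphisms, and let $k^\sharp\subseteq k^{alg}$ be the field of elements fixed by $G^\sharp$. *Structures.* Let $\tilde X^{et}$ be the set of the projective limit of the sets $X_{\mu,\alpha}(k^{alg})$ along the distinguished morphisms, with its projections $\mathbf p_{\mu,\alpha}:\tilde X^{et}\to X_{\mu,\alpha}(k^{alg})$. Let $\tilde{\mathbf X}^{et}_\sharp(k^{alg})$ be the structure with sorts $\tilde X^{et}$ and $k^{alg}$ (a field with names for the elements of $k$) and the maps $\mathbf p_\mu:(u,\alpha)\mapsto\mathbf p_{\mu,\alpha}(u)$.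 Let $\tilde{\mathbf X}^{et}(k^{alg})$ be the structure with sorts $\tilde X^{et}$, $k^{alg}$ (again a field with names for the elements of $k$) and, for each $\mu$, the sort $\tilde{\mathbf p}_\mu=\bigcup_\alpha\tilde{\mathbf p}_{\mu,\alpha}$, where $\tilde{\mathbf p}_{\mu,\alpha}=\{g\circ\mathbf p_{\mu,\alpha}:g\in\mathrm{GDeck}(X_{\mu,\alpha}/X)\}$, with the relation $p\in\tilde{\mathbf p}_{\mu,\alpha}$ between $p$ and $\alpha$, the actions of the groups $\mathrm{GDeck}(X_{\mu,\alpha}/X)$ (on whose elements $\mathrm{Gal}_k$ acts by conjugation) on $\tilde{\mathbf p}_{\mu,\alpha}$, and the evaluation maps $(p,u)\mapsto p(u)$; the maps $\mathbf p_{\mu,\alpha}$ themselves are not named. In both cases an automorphism acts on the field sort by an element of $\mathrm{Gal}_k$. **Theorem.** Suppose $k^\sharp=k$. Then: 1. every automorphism of $\tilde{\mathbf X}^{et}_\sharp(k^{alg})$ extends uniquely to an automorphism of $\tilde{\mathbf X}^{et}(k^{alg})$ (that is, to one with the same action on $\tilde X^{et}$ and on $k^{alg}$), and the restriction $\mathrm{Aut}\,\tilde{\mathbf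 X}^{et}_\sharp(k^{alg})\to\mathrm{Gal}_k$ to the field sort is bijective; so extension gives a map $t:\mathrm{Gal}_k\to\mathrm{Aut}\,\tilde{\mathbf X}^{et}(k^{alg})$, which is a homomorphism and a section of the restriction $\mathrm{Aut}\,\tilde{\mathbf X}^{et}(k^{alg})\to\mathrm{Gal}_k$; 2. for every $x\in X(k^{alg})$ the canonical homomorphism $\pi_1^{et}(X,x)\to\mathrm{Gal}_k$ has a continuous section, and this section comes from $t$: there are points $u\in\tilde X^{et}$ over $x$, and for each of them there is a continuous homomorphism $s:\mathrm{Gal}_k\to\pi_1^{et}(X,x)$ that is a section of the canonical homomorphism and satisfies, for all $\sigma$, all $\mu$ and all $q\in\tilde{\mathbf p}_\mu$, $$s(\sigma)\cdot q(u)=\bigl(t(\sigma)q\bigr)(u)$$ in the fibre of $X_\mu\to X$ over $x$. Here $\pi_1^{et}(X,x)$ is the automorphism group, with its profinite topology, of the fibre functor at $x$ on finite étale covers of $X$. The canonical homomorphism sends $\gamma$ to the $\sigma\in\mathrm{Gal}_k$ such that, for every finite extension $L\subseteq k^{alg}$ of $k$, $\gamma$ maps the point $(x,\varphi)$ of $X\times_kL$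 to $(x,\sigma\circ\varphi)$, for each $k$-embedding $\varphi:L\to k^{alg}$. -/

import Mathlib

open AlgebraicGeometry CategoryTheory CategoryTheory.Limits

universe u w

noncomputable section

namespace UnivCover

/-- The morphism of spectra induced by a ring homomorphism. -/
abbrev specHom {A B : Type u} [CommRing A] [CommRing B] (f : A →+* B) :
    Spec (CommRingCat.of B) ⟶ Spec (CommRingCat.of A) :=
  Spec.map (CommRingCat.ofHom f)

section Points

variable {k : Type u} [Field k]

/-- The group `Gal_k`. -/
abbrev GalK (k : Type u) [Field k] : Type u := AlgebraicClosure k ≃ₐ[k] AlgebraicClosure k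

/-- `Spec k^alg`. -/
abbrev SpecBar (k : Type u) [Field k] : Scheme.{u} := Spec (CommRingCat.of (AlgebraicClosure k))

/-- The set `Y(k^alg)` of `k^alg`-points of a `k`-scheme. -/
@[ext]
structure Pt {Y : Scheme.{u}} (t : Y ⟶ Spec (CommRingCat.of k)) : Type u where
  /-- the underlying morphism -/
  hom : SpecBar k ⟶ Y
  w : hom ≫ t = specHom (algebraMap k (AlgebraicClosure k))

lemma specHom_gal_comp (σ : GalK k) :
    specHom (σ : AlgebraicClosure k →+* AlgebraicClosure k) ≫
      specHom (algebraMap k (AlgebraicClosure k)) = specHom (algebraMap k (AlgebraicClosure k)) := by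
  rw [← Spec.map_comp, ← CommRingCat.ofHom_comp]
  congr 2
  exact RingHom.ext fun a => σ.commutes a

/-- `Gal_k` acts on `k^alg`-points (on coordinates). -/
instance {Y : Scheme.{u}} (t : Y ⟶ Spec (CommRingCat.of k)) : MulAction (GalK k) (Pt t) where
  smul σ y := ⟨specHom (σ : AlgebraicClosure k →+* AlgebraicClosure k) ≫ y.hom, by
    rw [Category.assoc, y.w, specHom_gal_comp]⟩
  one_smul y := Pt.ext (by
    change specHom (RingHom.id _) ≫ y.hom = y.hom
    simp [specHom])
  mul_smul σ τ y := Pt.ext (by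
    change specHom (RingHom.comp (σ : AlgebraicClosure k →+* AlgebraicClosure k)
      (τ : AlgebraicClosure k →+* AlgebraicClosure k)) ≫ y.hom = specHom _ ≫ specHom _ ≫ y.hom
    simp [specHom])

lemma Pt.smul_hom {Y : Scheme.{u}} {t : Y ⟶ Spec (CommRingCat.of k)} (σ : GalK k) (y : Pt t) :
    (σ • y).hom = specHom (σ : AlgebraicClosure k →+* AlgebraicClosure k) ≫ y.hom := rfl

end Points

section FundamentalGroup

/-- The category of finite étale covers of `X`. -/
abbrev FEt (X : Scheme.{u}) : Type (u + 1) :=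
  ObjectProperty.FullSubcategory (fun Y : Over X => IsFinite Y.hom ∧ Etale Y.hom)

variable {k : Type u} [Field k] {X : Scheme.{u}}

/-- The geometric fibre of `Y ⟶ X` over a geometric point `x` of `X`. -/
@[ext]
structure Fib (x : SpecBar k ⟶ X) (Y : FEt X) : Type u where
  /-- the underlying morphism -/
  hom : SpecBar k ⟶ Y.obj.left
  w : hom ≫ Y.obj.hom = x

instance (x : SpecBar k ⟶ X) (Y : FEt X) : Finite (Fib x Y) := by
  have := Y.property.1
  let p := pullback.snd Y.obj.hom x
  have hp : IsFinite p := inferInstance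
  have : IsAffine (pullback Y.obj.hom x) := isAffine_of_isAffineHom p
  let K := CommRingCat.of (AlgebraicClosure k)
  let φ : AlgebraicClosure k →+* Γ(pullback Y.obj.hom x, ⊤) :=
    p.appTop.hom.comp (Scheme.ΓSpecIso K).inv.hom
  let _ : Algebra (AlgebraicClosure k) Γ(pullback Y.obj.hom x, ⊤) := φ.toAlgebra
  have hfin : Module.Finite (AlgebraicClosure k) Γ(pullback Y.obj.hom x, ⊤) := by
    have h1 : p.appTop.hom.Finite := p.finite_appTop
    have h2 : (Scheme.ΓSpecIso K).inv.hom.Finite :=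
      RingHom.Finite.of_surjective _ (ConcreteCategory.bijective_of_isIso _).2
    exact h1.comp h2
  let F : Fib x Y → (Γ(pullback Y.obj.hom x, ⊤) →ₐ[AlgebraicClosure k] AlgebraicClosure k) :=
    fun y =>
      let l : Spec K ⟶ pullback Y.obj.hom x := pullback.lift y.hom (𝟙 _) (by simpa using y.w)
      { (Scheme.ΓSpecIso K).hom.hom.comp l.appTop.hom with
        commutes' := fun a => by
          have h : p.appTop ≫ l.appTop = 𝟙 _ := by
            have e : l ≫ p = 𝟙 (Spec K) := pullback.lift_snd _ _ _
            rw [← Scheme.Hom.comp_appTop, e, Scheme.Hom.id_appTop]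
          have h' := congr($(h) ((Scheme.ΓSpecIso K).inv a))
          change (Scheme.ΓSpecIso K).hom (l.appTop (p.appTop ((Scheme.ΓSpecIso K).inv a))) = a
          have h'' : l.appTop (p.appTop ((Scheme.ΓSpecIso K).inv a)) = (Scheme.ΓSpecIso K).inv a :=
            h'
          rw [h'']
          simp }
  refine Finite.of_injective F fun y z h => Fib.ext ?_
  have h2 : (pullback.lift y.hom (𝟙 _) (by simpa using y.w) : Spec K ⟶ pullback Y.obj.hom x) =
      pullback.lift z.hom (𝟙 _) (by simpa using z.w) := by
    refine ext_of_isAffine ?_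
    ext a
    have := congr($(h) a)
    exact (ConcreteCategory.bijective_of_isIso (Scheme.ΓSpecIso K).hom).1 this
  exact (pullback.lift_fst _ _ _).symm.trans
    (congr($(h2) ≫ pullback.fst _ _).trans (pullback.lift_fst _ _ _))

/-- The fibre functor of the geometric point `x` on finite étale covers. -/
def fibreFunctor (x : SpecBar k ⟶ X) : FEt X ⥤ FintypeCat.{u} where
  obj Y := FintypeCat.of (Fib x Y)
  map {Y Z} f := FintypeCat.homMk fun y => ⟨y.hom ≫ f.hom.left, by
    rw [Category.assoc, Over.w]; exact y.w⟩
  map_id Y := by ext y : 1; exact Fib.ext (Category.comp_id y.hom)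
  map_comp f g := by ext y : 1; exact Fib.ext (Category.assoc y.hom f.hom.left g.hom.left).symm

/-- The étale fundamental group. -/
abbrev PiOne (x : SpecBar k ⟶ X) : Type (u + 1) := Aut (fibreFunctor x)

/-- The action of the étale fundamental group on the geometric fibres over `x`. -/
def PiOne.act {x : SpecBar k ⟶ X} (γ : PiOne x) {Y : FEt X} (y : Fib x Y) : Fib x Y :=
  γ.hom.app Y y


end FundamentalGroup

section CanonicalHom

lemma specHom_injective {A B : Type u} [CommRing A] [CommRing B] {f g : A →+* B}
    (h : specHom f = specHom g) : f = g :=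
  congr($(Spec.map_injective h).hom)

lemma fibreFunctor_map_hom {k : Type u} [Field k] {X : Scheme.{u}} {x : SpecBar k ⟶ X} {Y Z : FEt X} (f : Y ⟶ Z) (y : Fib x Y) :
    Fib.hom ((fibreFunctor x).map f y) = y.hom ≫ f.hom.left := rfl

lemma PiOne.act_map {k : Type u} [Field k] {X : Scheme.{u}} {x : SpecBar k ⟶ X} (γ : PiOne x)
    {Y Z : FEt X} (f : Y ⟶ Z) (y : Fib x Y) :
    γ.act ((fibreFunctor x).map f y) = (fibreFunctor x).map f (γ.act y) :=
  congr($(γ.hom.naturality f) y)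

variable {k : Type u} [Field k] [CharZero k] {X : Scheme.{u}} (s : X ⟶ Spec (CommRingCat.of k))

/-- The finite étale cover `X ×_k L ⟶ X` given by a finite extension `L` of `k`. -/
def constCover (L : IntermediateField k (AlgebraicClosure k)) [FiniteDimensional k L] : FEt X where
  obj := Over.mk (pullback.fst s (specHom (algebraMap k L)))
  property := by
    have h1 : IsFinite (specHom (algebraMap k L)) := by
      rw [IsFinite.SpecMap_iff]
      exact RingHom.finite_algebraMap.2 inferInstance
    have h2 : Etale (specHom (algebraMap k L)) := by
      rw [HasRingHomProperty.Spec_iff (P := @Etale)]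
      have : Algebra.FormallyEtale k L := (Algebra.FormallyEtale.iff_isSeparable k L).2 inferInstance
      have : Algebra.Etale k L := ⟨inferInstance, Algebra.FinitePresentation.of_finiteType.1 inferInstance⟩
      exact RingHom.etale_algebraMap.2 this
    exact ⟨inferInstanceAs (IsFinite (pullback.fst _ _)), inferInstanceAs (Etale (pullback.fst _ _))⟩

section

variable (L L' : IntermediateField k (AlgebraicClosure k))
  [FiniteDimensional k L] [FiniteDimensional k L']

/-- The projection `X ×_k L ⟶ Spec L`. -/
def constProj : (constCover s L).obj.left ⟶ Spec (CommRingCat.of L) :=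
  pullback.snd s (specHom (algebraMap k L))

lemma constProj_comp : constProj s L ≫ specHom (algebraMap k L) = (constCover s L).obj.hom ≫ s :=
  pullback.condition.symm

lemma constCover_hom_ext {T : Scheme.{u}} {f g : T ⟶ (constCover s L).obj.left}
    (h₁ : f ≫ (constCover s L).obj.hom = g ≫ (constCover s L).obj.hom)
    (h₂ : f ≫ constProj s L = g ≫ constProj s L) : f = g :=
  pullback.hom_ext h₁ h₂

variable {L} in
/-- The morphism to `X ×_k L` given by morphisms to `X` and `Spec L`. -/
def constLift {T : Scheme.{u}} (f : T ⟶ X) (g : T ⟶ Spec (CommRingCat.of L))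
    (h : f ≫ s = g ≫ specHom (algebraMap k L)) : T ⟶ (constCover s L).obj.left :=
  pullback.lift f g h

variable {L} in
lemma constLift_hom {T : Scheme.{u}} (f : T ⟶ X) (g : T ⟶ Spec (CommRingCat.of L))
    (h : f ≫ s = g ≫ specHom (algebraMap k L)) :
    constLift s f g h ≫ (constCover s L).obj.hom = f :=
  pullback.lift_fst _ _ _

variable {L} in
lemma constLift_proj {T : Scheme.{u}} (f : T ⟶ X) (g : T ⟶ Spec (CommRingCat.of L))
    (h : f ≫ s = g ≫ specHom (algebraMap k L)) :
    constLift s f g h ≫ constProj s L = g :=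
  pullback.lift_snd _ _ _

end

variable {s} (x : Pt s) (L L' : IntermediateField k (AlgebraicClosure k))
  [FiniteDimensional k L] [FiniteDimensional k L']

/-- The point of `X ×_k L` over `x` given by an embedding of `L` in `k^alg`. -/
def constPt (φ : L →ₐ[k] AlgebraicClosure k) : Fib x.hom (constCover s L) where
  hom := constLift s x.hom (specHom (φ : L →+* AlgebraicClosure k)) (by
    rw [x.w, ← Spec.map_comp, ← CommRingCat.ofHom_comp, AlgHom.comp_algebraMap])
  w := constLift_hom _ _ _ _

variable {x L}

/-- The embedding of `L` in `k^alg` given by a point of `X ×_k L` over `x`. -/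
def constEmb (y : Fib x.hom (constCover s L)) : L →ₐ[k] AlgebraicClosure k :=
  { (Spec.preimage (y.hom ≫ constProj s L)).hom with
    commutes' := fun a => by
      have h : (CommRingCat.ofHom (algebraMap k L)) ≫ Spec.preimage (y.hom ≫ constProj s L) =
          CommRingCat.ofHom (algebraMap k (AlgebraicClosure k)) := by
        apply Spec.map_injective
        rw [Spec.map_comp, Spec.map_preimage, Category.assoc, constProj_comp,
          ← Category.assoc, y.w, x.w]
      exact congr($(h) a) }

lemma specHom_constEmb (y : Fib x.hom (constCover s L)) :
    specHom (constEmb y : L →+* AlgebraicClosure k) = y.hom ≫ constProj s L :=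
  Spec.map_preimage _

lemma constEmb_constPt (φ : L →ₐ[k] AlgebraicClosure k) : constEmb (constPt x L φ) = φ := by
  refine AlgHom.coe_ringHom_injective (specHom_injective ?_)
  rw [specHom_constEmb]
  exact constLift_proj _ _ _ _

lemma constPt_constEmb (y : Fib x.hom (constCover s L)) : constPt x L (constEmb y) = y :=
  Fib.ext (constCover_hom_ext s L ((constLift_hom _ _ _ _).trans y.w.symm)
    ((constLift_proj _ _ _ _).trans (specHom_constEmb y)))

variable {L'}

/-- The morphism `X ×_k L' ⟶ X ×_k L` given by an embedding of `L` in `L'`. -/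
def constMap (ψ : L →ₐ[k] L') : constCover s L' ⟶ constCover s L :=
  ObjectProperty.homMk (Over.homMk
    (constLift s (constCover s L').obj.hom (constProj s L' ≫ specHom (ψ : L →+* L')) (by
      rw [Category.assoc, ← Spec.map_comp, ← CommRingCat.ofHom_comp, AlgHom.comp_algebraMap,
        constProj_comp]))
    (constLift_hom _ _ _ _))

lemma constMap_proj (ψ : L →ₐ[k] L') :
    (constMap (s := s) ψ).hom.left ≫ constProj s L = constProj s L' ≫ specHom (ψ : L →+* L') :=
  constLift_proj _ _ _ _

lemma constEmb_map (ψ : L →ₐ[k] L') (y : Fib x.hom (constCover s L')) :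
    constEmb ((fibreFunctor x.hom).map (constMap ψ) y) = (constEmb y).comp ψ := by
  refine AlgHom.coe_ringHom_injective (specHom_injective ?_)
  refine (specHom_constEmb _).trans ?_
  rw [fibreFunctor_map_hom, Category.assoc, constMap_proj, ← Category.assoc, ← specHom_constEmb,
    ← Spec.map_comp]
  rfl

lemma constEmb_act_comp (γ : PiOne x.hom) (ψ : L →ₐ[k] L') (φ : L' →ₐ[k] AlgebraicClosure k) :
    constEmb (γ.act (constPt x L (φ.comp ψ))) = (constEmb (γ.act (constPt x L' φ))).comp ψ := by
  have h : constPt x L (φ.comp ψ) = (fibreFunctor x.hom).map (constMap ψ) (constPt x L' φ) := by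
    rw [← constPt_constEmb ((fibreFunctor x.hom).map (constMap ψ) (constPt x L' φ)), constEmb_map,
      constEmb_constPt]
  rw [h, PiOne.act_map, constEmb_map]

open IntermediateField in
instance (a : AlgebraicClosure k) : FiniteDimensional k k⟮a⟯ :=
  adjoin.finiteDimensional (Algebra.IsIntegral.isIntegral a)

open IntermediateField in
lemma constEmb_act_gen (γ : PiOne x.hom) (a : AlgebraicClosure k) (ha : a ∈ L) :
    constEmb (γ.act (constPt x k⟮a⟯ (val _))) (AdjoinSimple.gen k a) =
      constEmb (γ.act (constPt x L L.val)) ⟨a, ha⟩ := by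
  have h : k⟮a⟯ ≤ L := by simpa using ha
  exact congr($(constEmb_act_comp γ (inclusion h) L.val) (AdjoinSimple.gen k a))

variable (x)

open IntermediateField in
/-- The endomorphism of `k^alg` given by an element `γ` of the étale fundamental group: on a finite
extension `L` of `k` inside `k^alg` it is the embedding of `L` that corresponds to the `γ`-translate
of the point of `X ×_k L` given by `x` and the inclusion of `L` in `k^alg`. -/
def PiOne.toEnd (γ : PiOne x.hom) : AlgebraicClosure k →ₐ[k] AlgebraicClosure k where
  toFun a := constEmb (γ.act (constPt x k⟮a⟯ (val _))) (AdjoinSimple.gen k a)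
  map_one' := by
    rw [constEmb_act_gen (L := ⊥) γ 1 (one_mem _)]
    exact map_one _
  map_zero' := by
    rw [constEmb_act_gen (L := ⊥) γ 0 (zero_mem _)]
    exact map_zero _
  map_mul' a b := by
    have ha : a ∈ k⟮a⟯ ⊔ k⟮b⟯ := (le_sup_left : k⟮a⟯ ≤ _) (mem_adjoin_simple_self k a)
    have hb : b ∈ k⟮a⟯ ⊔ k⟮b⟯ := (le_sup_right : k⟮b⟯ ≤ _) (mem_adjoin_simple_self k b)
    rw [constEmb_act_gen γ a ha, constEmb_act_gen γ b hb, constEmb_act_gen γ _ (mul_mem ha hb),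
      ← map_mul]
    rfl
  map_add' a b := by
    have ha : a ∈ k⟮a⟯ ⊔ k⟮b⟯ := (le_sup_left : k⟮a⟯ ≤ _) (mem_adjoin_simple_self k a)
    have hb : b ∈ k⟮a⟯ ⊔ k⟮b⟯ := (le_sup_right : k⟮b⟯ ≤ _) (mem_adjoin_simple_self k b)
    rw [constEmb_act_gen γ a ha, constEmb_act_gen γ b hb, constEmb_act_gen γ _ (add_mem ha hb),
      ← map_add]
    rfl
  commutes' a := by
    rw [constEmb_act_gen (L := ⊥) γ _ (IntermediateField.algebraMap_mem _ a)]
    exact AlgHom.commutes _ a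

open IntermediateField in
lemma PiOne.constEmb_act (γ : PiOne x.hom) (φ : L →ₐ[k] AlgebraicClosure k) :
    constEmb (γ.act (constPt x L φ)) = (PiOne.toEnd x γ).comp φ := by
  ext a
  have : FiniteDimensional k φ.fieldRange := φ.toLinearMap.finiteDimensional_range
  let ψ : L →ₐ[k] φ.fieldRange := φ.codRestrict φ.fieldRange.toSubalgebra fun a => ⟨a, rfl⟩
  have h : constEmb (γ.act (constPt x L (φ.fieldRange.val.comp ψ))) a =
      constEmb (γ.act (constPt x φ.fieldRange φ.fieldRange.val)) (ψ a) :=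
    congr($(constEmb_act_comp γ ψ φ.fieldRange.val) a)
  exact h.trans (constEmb_act_gen γ (φ a) (ψ a).2).symm

/-- The canonical homomorphism from the étale fundamental group to `Gal_k`. -/
def PiOne.toGal : PiOne x.hom →* GalK k :=
  ((Algebra.IsAlgebraic.algEquivEquivAlgHom k (AlgebraicClosure k)).symm.toMonoidHom).comp
    { toFun := PiOne.toEnd x
      map_one' := AlgHom.ext fun a =>
        congr($(constEmb_constPt (x := x) (IntermediateField.val _))
          (IntermediateField.AdjoinSimple.gen k a))
      map_mul' := fun γ δ => AlgHom.ext fun a => by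
        change constEmb (γ.act (δ.act (constPt x _ (IntermediateField.val _)))) _ = _
        rw [← constPt_constEmb (δ.act _), PiOne.constEmb_act]
        rfl }

end CanonicalHom

section Covers

variable {k : Type u} [Field k]

/-- The ring of global functions of a `k`-scheme, as a `k`-algebra. -/
def GlobalFn {Y : Scheme.{u}} (_ : Y ⟶ Spec (CommRingCat.of k)) : Type u := Γ(Y, ⊤)

instance {Y : Scheme.{u}} (t : Y ⟶ Spec (CommRingCat.of k)) : CommRing (GlobalFn t) :=
  inferInstanceAs (CommRing Γ(Y, ⊤))

instance {Y : Scheme.{u}} (t : Y ⟶ Spec (CommRingCat.of k)) : Algebra k (GlobalFn t) :=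
  RingHom.toAlgebra
    ((Scheme.Hom.appTop t).hom.comp (Scheme.ΓSpecIso (CommRingCat.of k)).inv.hom : k →+* Γ(Y, ⊤))

/-- The algebra of constant functions on a `k`-scheme: the functions that are algebraic over `k`.
For a connected reduced scheme of finite type it is a finite field extension of `k`. -/
abbrev ConstFn {Y : Scheme.{u}} (t : Y ⟶ Spec (CommRingCat.of k)) : Subalgebra k (GlobalFn t) :=
  integralClosure k (GlobalFn t)

/-- The morphism from a `k`-scheme to the spectrum of its algebra of constant functions. -/
def toConst {Y : Scheme.{u}} (t : Y ⟶ Spec (CommRingCat.of k)) :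
    Y ⟶ Spec (CommRingCat.of (ConstFn t)) :=
  Y.toSpecΓ ≫ Spec.map (CommRingCat.ofHom (R := ConstFn t) (S := Γ(Y, ⊤))
    ((ConstFn t).val : ConstFn t →+* GlobalFn t))

lemma toConst_comp {Y : Scheme.{u}} (t : Y ⟶ Spec (CommRingCat.of k)) :
    toConst t ≫ specHom (algebraMap k (ConstFn t)) = t := by
  rw [toConst, Category.assoc, ← Spec.map_comp]
  have h : CommRingCat.ofHom (algebraMap k (ConstFn t)) ≫
      CommRingCat.ofHom (R := ConstFn t) (S := Γ(Y, ⊤))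
        ((ConstFn t).val : ConstFn t →+* GlobalFn t) =
      (Scheme.ΓSpecIso (CommRingCat.of k)).inv ≫ Scheme.Hom.appTop t := rfl
  rw [h, Spec.map_comp, ← Category.assoc, ← Scheme.toSpecΓ_naturality, Category.assoc]
  simp

variable {X : Scheme.{u}}

/-- A finite étale cover of `X` is Galois if it is connected and its automorphism group acts
transitively on the fibres over the `k^alg`-points of `X`. -/
def IsGaloisCover (s : X ⟶ Spec (CommRingCat.of k)) (Y : FEt X) : Prop :=
  ConnectedSpace Y.obj.left ∧
    ∀ (x : Pt s) (y z : Fib x.hom Y), ∃ g : Y ≅ Y, (fibreFunctor x.hom).map g.hom y = z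

/-- A family of finite Galois étale covers `X_μ ⟶ X` that suffices to dominate all of them; one can take
a family that contains every finite Galois étale cover up to isomorphism. -/
structure CoverFamily (s : X ⟶ Spec (CommRingCat.of k)) where
  /-- the names `μ` -/
  Name : Type w
  /-- the cover named `μ` -/
  cover : Name → FEt X
  galois : ∀ μ, IsGaloisCover s (cover μ)
  dominates : ∀ Y : FEt X, IsGaloisCover s Y → ∃ μ, Nonempty (cover μ ⟶ Y)

variable {s : X ⟶ Spec (CommRingCat.of k)} (M : CoverFamily.{u, w} s)

namespace CoverFamily

/-- The structure morphism of `X_μ` over `k`. -/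
def str (μ : M.Name) : (M.cover μ).obj.left ⟶ Spec (CommRingCat.of k) := (M.cover μ).obj.hom ≫ s

/-- The pairs `(μ, α)`, where `α` is an embedding over `k` of the field `k^μ` of constant functions
of `X_μ` in `k^alg`. (If `k^μ = k[a]` and `f_μ` is the minimal polynomial of `a` then `α` amounts to
a zero of `f_μ`, the value of `a`.) -/
@[ext]
structure Index where
  /-- the name `μ` -/
  name : M.Name
  /-- the embedding `α` -/
  emb : ConstFn (M.str name) →ₐ[k] AlgebraicClosure k

/-- `Gal_k` acts on the embeddings `α`. -/
instance : MulAction (GalK k) M.Index where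
  smul σ i := ⟨i.name, (σ : AlgebraicClosure k →ₐ[k] AlgebraicClosure k).comp i.emb⟩
  one_smul _ := rfl
  mul_smul _ _ _ := rfl

variable {M}

/-- The variety `X_{μ,α}` over `k^alg`: the base change of `X_μ` along `α`. -/
def geom (i : M.Index) : Scheme.{u} :=
  pullback (toConst (M.str i.name)) (specHom (i.emb : _ →+* AlgebraicClosure k))

/-- The projection of `X_{μ,α}` to `X_μ`. -/
def geomProj (i : M.Index) : geom i ⟶ (M.cover i.name).obj.left := pullback.fst _ _

/-- The structure morphism of `X_{μ,α}` over `k^alg`. -/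
def geomStr (i : M.Index) : geom i ⟶ SpecBar k := pullback.snd _ _

lemma geom_condition (i : M.Index) : geomProj i ≫ toConst (M.str i.name) =
    geomStr i ≫ specHom (i.emb : _ →+* AlgebraicClosure k) :=
  pullback.condition

/-- The covering map `μ_α : X_{μ,α} ⟶ X`. -/
def geomMap (i : M.Index) : geom i ⟶ X := geomProj i ≫ (M.cover i.name).obj.hom

/-- The morphism to `X_{μ,α}` given by morphisms to `X_μ` and `Spec k^alg`. -/
def geomLift {T : Scheme.{u}} (i : M.Index) (f : T ⟶ (M.cover i.name).obj.left) (g : T ⟶ SpecBar k)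
    (h : f ≫ toConst (M.str i.name) = g ≫ specHom (i.emb : _ →+* AlgebraicClosure k)) :
    T ⟶ geom i :=
  pullback.lift f g h

lemma geomLift_proj {T : Scheme.{u}} (i : M.Index) (f : T ⟶ (M.cover i.name).obj.left)
    (g : T ⟶ SpecBar k)
    (h : f ≫ toConst (M.str i.name) = g ≫ specHom (i.emb : _ →+* AlgebraicClosure k)) :
    geomLift i f g h ≫ geomProj i = f :=
  pullback.lift_fst _ _ _

lemma geomLift_str {T : Scheme.{u}} (i : M.Index) (f : T ⟶ (M.cover i.name).obj.left)
    (g : T ⟶ SpecBar k)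
    (h : f ≫ toConst (M.str i.name) = g ≫ specHom (i.emb : _ →+* AlgebraicClosure k)) :
    geomLift i f g h ≫ geomStr i = g :=
  pullback.lift_snd _ _ _

lemma geom_hom_ext {T : Scheme.{u}} {i : M.Index} {f g : T ⟶ geom i}
    (h₁ : f ≫ geomProj i = g ≫ geomProj i) (h₂ : f ≫ geomStr i = g ≫ geomStr i) : f = g :=
  pullback.hom_ext h₁ h₂

/-- The canonical isomorphism of schemes from `X_{μ,σ(α)}` to `X_{μ,α}` over the automorphism
of `Spec k^alg` given by `σ`. -/
def twist (σ : GalK k) (i : M.Index) : geom (σ • i) ⟶ geom i :=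
  geomLift i (geomProj (σ • i))
    (geomStr (σ • i) ≫ specHom (σ : AlgebraicClosure k →+* AlgebraicClosure k)) (by
      rw [Category.assoc, ← Spec.map_comp]
      exact geom_condition (σ • i))

lemma twist_proj (σ : GalK k) (i : M.Index) : twist σ i ≫ geomProj i = geomProj (σ • i) :=
  geomLift_proj _ _ _ _

lemma twist_str (σ : GalK k) (i : M.Index) : twist σ i ≫ geomStr i =
    geomStr (σ • i) ≫ specHom (σ : AlgebraicClosure k →+* AlgebraicClosure k) :=
  geomLift_str _ _ _ _

lemma twist_one (i : M.Index) : twist 1 i = 𝟙 (geom i) := by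
  refine geom_hom_ext ?_ ?_
  · exact (twist_proj 1 i).trans (Category.id_comp (geomProj i)).symm
  · have h : geomStr i ≫ specHom (RingHom.id (AlgebraicClosure k)) = 𝟙 (geom i) ≫ geomStr i := by
      rw [Category.id_comp]
      exact (congrArg (geomStr i ≫ ·) (Spec.map_id _)).trans (Category.comp_id _)
    exact (twist_str 1 i).trans h

lemma twist_mul (σ τ : GalK k) (i : M.Index) :
    twist (σ * τ) i = (twist σ (τ • i) ≫ twist τ i : geom (σ • τ • i) ⟶ geom i) := by
  have h₁ : (twist σ (τ • i) ≫ twist τ i) ≫ geomProj i = geomProj (σ • τ • i) := by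
    rw [Category.assoc, twist_proj]
    exact twist_proj σ (τ • i)
  have h₂ : (twist σ (τ • i) ≫ twist τ i) ≫ geomStr i = geomStr (σ • τ • i) ≫
      specHom ((σ : AlgebraicClosure k →+* AlgebraicClosure k).comp
        (τ : AlgebraicClosure k →+* AlgebraicClosure k)) := by
    rw [Category.assoc, twist_str, ← Category.assoc, twist_str, Category.assoc, ← Spec.map_comp]
    rfl
  exact geom_hom_ext ((twist_proj _ _).trans h₁.symm) ((twist_str _ _).trans h₂.symm)

/-- Intermediate morphisms `X_{μ,α} ⟶ X_{ν,β}`: the morphisms over `k^alg` and over `X`. -/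
@[ext]
structure GeomHom (i j : M.Index) where
  /-- the underlying morphism of schemes -/
  hom : geom i ⟶ geom j
  w_str : hom ≫ geomStr j = geomStr i
  w_map : hom ≫ geomMap j = geomMap i

/-- The identity of `X_{μ,α}`. -/
def GeomHom.id (i : M.Index) : GeomHom i i := ⟨𝟙 _, Category.id_comp _, Category.id_comp _⟩

/-- The composite of two intermediate morphisms. -/
def GeomHom.comp {i j l : M.Index} (g : GeomHom j l) (f : GeomHom i j) : GeomHom i l where
  hom := f.hom ≫ g.hom
  w_str := by rw [Category.assoc, g.w_str, f.w_str]
  w_map := by rw [Category.assoc, g.w_map, f.w_map]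

/-- The conjugate `f^σ : X_{μ,σ(α)} ⟶ X_{ν,σ(β)}` of an intermediate morphism: `σ` is applied to the
coefficients of `f`. -/
def GeomHom.conj (σ : GalK k) {i j : M.Index} (f : GeomHom i j) : GeomHom (σ • i) (σ • j) where
  hom := geomLift (σ • j) (twist σ i ≫ f.hom ≫ geomProj j) (geomStr (σ • i)) (by
    change (twist σ i ≫ f.hom ≫ geomProj j) ≫ toConst (M.str j.name) = _
    simp only [Category.assoc]
    rw [geom_condition, ← Category.assoc f.hom, f.w_str, ← Category.assoc, twist_str,
      Category.assoc, ← Spec.map_comp]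
    rfl)
  w_str := geomLift_str _ _ _ _
  w_map := by
    change _ ≫ geomProj (σ • j) ≫ _ = _
    rw [← Category.assoc, geomLift_proj]
    change (twist σ i ≫ f.hom ≫ geomProj j) ≫ (M.cover j.name).obj.hom = _
    have h : f.hom ≫ geomProj j ≫ (M.cover j.name).obj.hom = geomMap i := f.w_map
    simp only [Category.assoc]
    rw [h, geomMap, ← Category.assoc, twist_proj]
    rfl

lemma GeomHom.conj_twist (σ : GalK k) {i j : M.Index} (f : GeomHom i j) :
    (f.conj σ).hom ≫ twist σ j = twist σ i ≫ f.hom := by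
  refine geom_hom_ext ?_ ?_
  · rw [Category.assoc, twist_proj, Category.assoc]
    exact geomLift_proj _ _ _ _
  · rw [Category.assoc, twist_str, Category.assoc, f.w_str, twist_str, ← Category.assoc,
      (f.conj σ).w_str]

lemma GeomHom.conj_proj (σ : GalK k) {i j : M.Index} (f : GeomHom i j) :
    (f.conj σ).hom ≫ geomProj (σ • j) = twist σ i ≫ f.hom ≫ geomProj j :=
  geomLift_proj _ _ _ _

lemma GeomHom.conj_one {i j : M.Index} (f : GeomHom i j) : f.conj 1 = f := by
  refine GeomHom.ext (geom_hom_ext ?_ ?_)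
  · refine (f.conj_proj 1).trans ?_
    rw [twist_one]
    exact Category.id_comp _
  · exact (f.conj 1).w_str.trans f.w_str.symm

lemma GeomHom.conj_mul (σ τ : GalK k) {i j : M.Index} (f : GeomHom i j) :
    f.conj (σ * τ) = (f.conj τ).conj σ := by
  refine GeomHom.ext (geom_hom_ext ?_ ?_)
  · have h : ((f.conj τ).conj σ).hom ≫ geomProj (σ • τ • j) =
        (twist σ (τ • i) ≫ twist τ i) ≫ f.hom ≫ geomProj j := by
      rw [GeomHom.conj_proj, GeomHom.conj_proj]
      exact (Category.assoc _ _ _).symm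
    refine (f.conj_proj (σ * τ)).trans (Eq.trans ?_ h.symm)
    rw [twist_mul]
    rfl
  · exact (f.conj (σ * τ)).w_str.trans ((f.conj τ).conj σ).w_str.symm

lemma GeomHom.nonempty_conj (σ : GalK k) {i j : M.Index} (h : Nonempty (GeomHom i j)) :
    Nonempty (GeomHom (σ • i) (σ • j)) :=
  h.map (GeomHom.conj σ)

lemma GeomHom.nonempty_of_conj (σ : GalK k) {i j : M.Index}
    (h : Nonempty (GeomHom (σ • i) (σ • j))) : Nonempty (GeomHom i j) := by
  have h' := GeomHom.nonempty_conj σ⁻¹ h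
  rwa [inv_smul_smul, inv_smul_smul] at h'

lemma GeomHom.conj_surjective (σ : GalK k) {i j : M.Index} (g : GeomHom (σ • i) (σ • j)) :
    ∃ f : GeomHom i j, f.conj σ = g := by
  have h₁ : ∀ (a b : M.Index) (_ : a = i) (_ : b = j) (x : GeomHom a b),
      ∃ f : GeomHom i j, HEq (f.conj σ) (x.conj σ) := by
    rintro a b rfl rfl x
    exact ⟨x, HEq.rfl⟩
  have h₂ : ∀ τ : GalK k, τ = 1 → HEq (g.conj τ) g := by
    rintro τ rfl
    exact heq_of_eq g.conj_one
  obtain ⟨f, hf⟩ := h₁ _ _ (inv_smul_smul σ i) (inv_smul_smul σ j) (g.conj σ⁻¹)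
  refine ⟨f, eq_of_heq (hf.trans ?_)⟩
  exact (heq_of_eq (g.conj_mul σ σ⁻¹).symm).trans (h₂ _ (mul_inv_cancel σ))

/-- The points of `X_{μ,α}(k^alg)`. -/
@[ext]
structure GeomPt (i : M.Index) where
  /-- the underlying morphism -/
  hom : SpecBar k ⟶ geom i
  w : hom ≫ geomStr i = 𝟙 _

lemma GeomHom.conj_id (σ : GalK k) (i : M.Index) : (GeomHom.id i).conj σ = GeomHom.id (σ • i) := by
  refine GeomHom.ext (geom_hom_ext ?_ ?_)
  · refine (GeomHom.conj_proj σ (GeomHom.id i)).trans ?_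
    have h : twist σ i ≫ (GeomHom.id i).hom ≫ geomProj i = geomProj (σ • i) := by
      rw [GeomHom.id, Category.id_comp, twist_proj]
    exact h.trans (Category.id_comp _).symm
  · exact ((GeomHom.id i).conj σ).w_str.trans (GeomHom.id (σ • i)).w_str.symm

lemma GeomHom.conj_comp (σ : GalK k) {i j l : M.Index} (g : GeomHom j l) (f : GeomHom i j) :
    (g.comp f).conj σ = (g.conj σ).comp (f.conj σ) := by
  refine GeomHom.ext (geom_hom_ext ?_ ?_)
  · refine ((g.comp f).conj_proj σ).trans ?_
    rw [GeomHom.comp, GeomHom.comp, Category.assoc, Category.assoc, g.conj_proj, ← Category.assoc,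
      ← f.conj_twist, Category.assoc]
  · exact ((g.comp f).conj σ).w_str.trans ((g.conj σ).comp (f.conj σ)).w_str.symm

lemma GeomHom.isIso_conj (σ : GalK k) {i j : M.Index} (f : GeomHom i j) (hf : IsIso f.hom) :
    IsIso (f.conj σ).hom := by
  let g : GeomHom j i := ⟨inv f.hom, by rw [IsIso.inv_comp_eq, f.w_str],
    by rw [IsIso.inv_comp_eq, f.w_map]⟩
  have h₁ : g.comp f = GeomHom.id i := GeomHom.ext (IsIso.hom_inv_id f.hom)
  have h₂ : f.comp g = GeomHom.id j := GeomHom.ext (IsIso.inv_hom_id f.hom)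
  refine ⟨(g.conj σ).hom, ?_, ?_⟩
  · exact congrArg GeomHom.hom ((GeomHom.conj_comp σ g f).symm.trans
      ((congrArg (GeomHom.conj σ) h₁).trans (GeomHom.conj_id σ i)))
  · exact congrArg GeomHom.hom ((GeomHom.conj_comp σ f g).symm.trans
      ((congrArg (GeomHom.conj σ) h₂).trans (GeomHom.conj_id σ j)))

lemma GeomHom.isIso_of_conj (σ : GalK k) {i j : M.Index} (f : GeomHom i j)
    (hf : IsIso (f.conj σ).hom) : IsIso f.hom := by
  have h : ∀ τ : GalK k, τ = 1 → IsIso (f.conj τ).hom → IsIso f.hom := by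
    rintro τ rfl h
    rwa [f.conj_one] at h
  refine h _ (inv_mul_cancel σ) ?_
  rw [f.conj_mul]
  exact GeomHom.isIso_conj σ⁻¹ (f.conj σ) hf

/-- A point of `X_{μ,α}(k^alg)` as a point of `X_μ(k^alg)`. In this way `X_μ(k^alg)` is the disjoint
union of the `X_{μ,α}(k^alg)`, and `Gal_k` acts on it. -/
def GeomPt.toPt {i : M.Index} (t : GeomPt i) : Pt (M.str i.name) where
  hom := t.hom ≫ geomProj i
  w := by
    rw [← toConst_comp (M.str i.name), Category.assoc, ← Category.assoc (geomProj i), geom_condition,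
      Category.assoc, ← Category.assoc, t.w, Category.id_comp, ← Spec.map_comp,
      ← CommRingCat.ofHom_comp, AlgHom.comp_algebraMap]

/-- The action of an intermediate morphism on points. -/
def GeomHom.app {i j : M.Index} (f : GeomHom i j) (t : GeomPt i) : GeomPt j where
  hom := t.hom ≫ f.hom
  w := by rw [Category.assoc, f.w_str, t.w]

end CoverFamily

open CoverFamily

/-- A projective system of distinguished intermediate morphisms
`(ν_β⁻¹ μ_α) : X_{μ,α} ⟶ X_{ν,β}`: one for each pair of covers between which there is an
intermediate morphism, such that identities and composites of distinguished morphisms are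
distinguished. -/
structure DistinguishedSystem (M : CoverFamily.{u, w} s) where
  /-- the distinguished morphism from `i` to `j` -/
  hom : ∀ i j : M.Index, Nonempty (GeomHom i j) → GeomHom i j
  hom_id : ∀ i h, hom i i h = GeomHom.id i
  hom_comp : ∀ i j l h₁ h₂ h₃, (hom j l h₂).comp (hom i j h₁) = hom i l h₃

namespace DistinguishedSystem

variable {M} (D : DistinguishedSystem M)

/-- The group `G^♯` of the elements of `Gal_k` that preserve the family of all distinguished
morphisms. -/
def GSharp : Subgroup (GalK k) where
  carrier := {σ | ∀ i j h, (D.hom i j h).conj σ =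
    D.hom (σ • i) (σ • j) (GeomHom.nonempty_conj σ h)}
  one_mem' _ _ _ := GeomHom.conj_one _
  mul_mem' {σ τ} hσ hτ i j h := by
    rw [GeomHom.conj_mul, hτ, hσ]
    rfl
  inv_mem' {σ} hσ i j h := by
    obtain ⟨a, rfl⟩ : ∃ a, i = σ • a := ⟨σ⁻¹ • i, (smul_inv_smul σ i).symm⟩
    obtain ⟨b, rfl⟩ : ∃ b, j = σ • b := ⟨σ⁻¹ • j, (smul_inv_smul σ j).symm⟩
    have h₀ := GeomHom.nonempty_of_conj σ h
    have h₁ : ∀ τ : GalK k, τ = 1 → (D.hom a b h₀).conj τ =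
        D.hom (τ • a) (τ • b) (GeomHom.nonempty_conj τ h₀) := by
      rintro τ rfl
      exact GeomHom.conj_one _
    rw [← hσ a b h₀, ← GeomHom.conj_mul]
    exact h₁ _ (inv_mul_cancel σ)

/-- The field `k^♯`: the subfield of `k^alg` that is fixed pointwise by `G^♯`. -/
def kSharp : IntermediateField k (AlgebraicClosure k) := IntermediateField.fixedField D.GSharp

/-- The universal étale cover: the projective limit of the sets `X_{μ,α}(k^alg)` along the
distinguished morphisms. -/
@[ext]
structure UnivCov where
  /-- the maps `p_{μ,α}` -/
  pt : ∀ i : M.Index, GeomPt i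
  compat : ∀ i j h, (D.hom i j h).app (pt i) = pt j

variable {D}

/-- The point of the universal étale cover lies over the point `x` of `X`. -/
def UnivCov.LiesOver (u : D.UnivCov) (x : Pt s) : Prop :=
  ∀ i : M.Index, (u.pt i).hom ≫ geomMap i = x.hom

/-- The map `p_{μ,α}` from the universal étale cover to `X_{μ,α}(k^alg) ⊆ X_μ(k^alg)`. -/
def pMap (i : M.Index) (u : D.UnivCov) : Pt (M.str i.name) := (u.pt i).toPt

/-- `q` is the map `g ∘ p_{μ,α}`. -/
def IsTranslate {i : M.Index} (g : GeomHom i i) (q : D.UnivCov → Pt (M.str i.name)) : Prop :=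
  ∀ u, q u = (g.app (u.pt i)).toPt

/-- `q` belongs to the set of all maps `g ∘ p_{μ,α}`, where `g` is in the geometric deck
transformation group of `X_{μ,α}` over `X`. -/
def InFibre (i : M.Index) (q : D.UnivCov → Pt (M.str i.name)) : Prop :=
  ∃ g : GeomHom i i, IsIso g.hom ∧ IsTranslate g q

variable (D) in
/-- The structure with the sorts `X̃` and `k^alg` (with names for the elements of `k`)
and the maps `p_μ : (u, α) ↦ p_{μ,α}(u)`, through its automorphism group: the pairs of a permutation
of `X̃` and an element of `Gal_k` that respect all `p_μ`. -/
def AutSharp : Subgroup (Equiv.Perm D.UnivCov × GalK k) where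
  carrier := {τ | ∀ (i : M.Index) (u : D.UnivCov), pMap (τ.2 • i) (τ.1 u) = τ.2 • pMap i u}
  one_mem' i u := (one_smul _ _).symm
  mul_mem' {σ τ} hσ hτ i u := by
    exact (hσ (τ.2 • i) (τ.1 u)).trans ((congrArg (σ.2 • ·) (hτ i u)).trans
      (mul_smul σ.2 τ.2 (pMap i u)).symm)
  inv_mem' {τ} hτ i u := by
    obtain ⟨a, rfl⟩ : ∃ a, i = τ.2 • a := ⟨τ.2⁻¹ • i, (smul_inv_smul τ.2 i).symm⟩
    obtain ⟨v, rfl⟩ := τ.1.surjective u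
    have h : ∀ σ : GalK k, σ = 1 → pMap (σ • a) v = (pMap a v : Pt (M.str a.name)) := by
      rintro σ rfl
      rfl
    have e : (τ⁻¹).1 (τ.1 v) = v := Equiv.symm_apply_apply τ.1 v
    rw [e, hτ]
    refine (h _ (inv_mul_cancel τ.2)).trans ?_
    exact (inv_smul_smul τ.2 (pMap a v)).symm

variable (D) in
/-- The finite sort of all maps `g ∘ p_{μ,α}` for a fixed `μ`. -/
def PTilde (μ : M.Name) : Type _ :=
  {q : D.UnivCov → Pt (M.str μ) // ∃ α, InFibre ⟨μ, α⟩ q}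

/-- `q` is in the fibre with index `i` of the sort of all maps `g ∘ p_{μ,α}`, and `q'` is the image
`g * q` of `q` under the action of `g`. -/
def ActsTo {i : M.Index} (g : GeomHom i i) (q q' : D.UnivCov → Pt (M.str i.name)) : Prop :=
  ∃ d : GeomHom i i, IsIso d.hom ∧ IsTranslate d q ∧ IsTranslate (g.comp d) q'

variable (D) in
/-- The structure `X̃^et(k^alg)` through its automorphism group. Its sorts are
`X̃`, `k^alg` (a field, with names for the elements of `k`) and, for each `μ`, the finite sort
of all maps `g ∘ p_{μ,α}`, on which the fibres over the `α`, the actions of the deck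
transformation groups (these are interpreted in `k^alg`, so that `Gal_k` acts on their elements by
conjugation), and the evaluation of a map at a point of `X̃` are named. An
automorphism is a family of bijections of the sorts that respects all this. -/
def AutEt : Subgroup (Equiv.Perm D.UnivCov × GalK k × ∀ μ, Equiv.Perm (D.PTilde μ)) where
  carrier := {τ |
    (∀ (i : M.Index) (q : D.PTilde i.name),
      InFibre i q.1 ↔ InFibre (τ.2.1 • i) (τ.2.2 i.name q).1) ∧
    (∀ (i : M.Index) (g : GeomHom i i), IsIso g.hom → ∀ q q' : D.PTilde i.name,
      ActsTo g q.1 q'.1 ↔ ActsTo (g.conj τ.2.1) (τ.2.2 i.name q).1 (τ.2.2 i.name q').1) ∧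
    (∀ (μ : M.Name) (q : D.PTilde μ) (u : D.UnivCov), (τ.2.2 μ q).1 (τ.1 u) = τ.2.1 • q.1 u)}
  one_mem' := by
    refine ⟨fun i q => Iff.rfl, fun i g _ q q' => ?_, fun μ q u => (one_smul _ _).symm⟩
    change _ ↔ ActsTo (g.conj 1) q.1 q'.1
    rw [g.conj_one]
    rfl
  mul_mem' {σ τ} hσ hτ := by
    refine ⟨fun i q => ?_, fun i g hg q q' => ?_, fun μ q u => ?_⟩
    · exact (hτ.1 i q).trans (hσ.1 (τ.2.1 • i) (τ.2.2 i.name q))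
    · refine (hτ.2.1 i g hg q q').trans ?_
      have h := hσ.2.1 (τ.2.1 • i) (g.conj τ.2.1) (g.isIso_conj _ hg) (τ.2.2 i.name q)
        (τ.2.2 i.name q')
      rw [← GeomHom.conj_mul] at h
      exact h
    · exact (hσ.2.2 μ (τ.2.2 μ q) (τ.1 u)).trans ((congrArg (σ.2.1 • ·) (hτ.2.2 μ q u)).trans
        (mul_smul σ.2.1 τ.2.1 (q.1 u)).symm)
  inv_mem' {τ} hτ := by
    refine ⟨fun i q => ?_, fun i g hg q q' => ?_, fun μ q u => ?_⟩
    · obtain ⟨a, rfl⟩ : ∃ a, i = τ.2.1 • a := ⟨τ.2.1⁻¹ • i, (smul_inv_smul τ.2.1 i).symm⟩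
      obtain ⟨r, rfl⟩ := (τ.2.2 a.name).surjective q
      have h : ∀ σ : GalK k, σ = 1 → (InFibre a r.1 ↔ InFibre (D := D) (σ • a) r.1) := by
        rintro σ rfl
        rfl
      have e : (τ⁻¹).2.2 a.name (τ.2.2 a.name r) = r := Equiv.symm_apply_apply _ r
      refine (hτ.1 a r).symm.trans ((h _ (inv_mul_cancel τ.2.1)).trans ?_)
      change _ ↔ InFibre (D := D) (τ.2.1⁻¹ • τ.2.1 • a) ((τ⁻¹).2.2 a.name (τ.2.2 a.name r)).1
      rw [e]
      rfl
    · obtain ⟨a, rfl⟩ : ∃ a, i = τ.2.1 • a := ⟨τ.2.1⁻¹ • i, (smul_inv_smul τ.2.1 i).symm⟩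
      obtain ⟨f, rfl⟩ := GeomHom.conj_surjective τ.2.1 g
      obtain ⟨r, rfl⟩ := (τ.2.2 a.name).surjective q
      obtain ⟨r', rfl⟩ := (τ.2.2 a.name).surjective q'
      have h : ∀ σ : GalK k, σ = 1 →
          (ActsTo f r.1 r'.1 ↔ ActsTo (D := D) (f.conj σ) r.1 r'.1) := by
        rintro σ rfl
        rw [f.conj_one]
        rfl
      have e : (τ⁻¹).2.2 a.name (τ.2.2 a.name r) = r := Equiv.symm_apply_apply _ r
      have e' : (τ⁻¹).2.2 a.name (τ.2.2 a.name r') = r' := Equiv.symm_apply_apply _ r'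
      refine (hτ.2.1 a f (f.isIso_of_conj _ hg) r r').symm.trans
        ((h _ (inv_mul_cancel τ.2.1)).trans ?_)
      rw [f.conj_mul]
      change _ ↔ ActsTo (D := D) ((f.conj τ.2.1).conj τ.2.1⁻¹)
        ((τ⁻¹).2.2 a.name (τ.2.2 a.name r)).1 ((τ⁻¹).2.2 a.name (τ.2.2 a.name r')).1
      rw [e, e']
      rfl
    · obtain ⟨r, rfl⟩ := (τ.2.2 μ).surjective q
      obtain ⟨v, rfl⟩ := τ.1.surjective u
      have e : (τ⁻¹).2.2 μ (τ.2.2 μ r) = r := Equiv.symm_apply_apply _ r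
      have e' : (τ⁻¹).1 (τ.1 v) = v := Equiv.symm_apply_apply _ v
      rw [e, e', hτ.2.2]
      exact (inv_smul_smul τ.2.1 (r.1 v)).symm

/-- The restriction of automorphisms to the field sort. -/
def AutSharp.toGal : D.AutSharp →* GalK k :=
  (MonoidHom.snd _ _).comp D.AutSharp.subtype

/-- The restriction of automorphisms to the field sort. -/
def AutEt.toGal : D.AutEt →* GalK k :=
  (MonoidHom.fst _ _).comp ((MonoidHom.snd _ _).comp D.AutEt.subtype)

/-- The action of automorphisms on the sort of all maps `g ∘ p_{μ,α}`. -/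
def AutEt.onPTilde (τ : D.AutEt) {μ : M.Name} (q : D.PTilde μ) : D.PTilde μ := τ.1.2.2 μ q

/-- The automorphism `τ'` of `X̃^et(k^alg)` extends the automorphism `τ` of the structure with
the sorts `X̃` and `k^alg`. -/
def Extends (τ' : D.AutEt) (τ : D.AutSharp) : Prop :=
  τ'.1.1 = τ.1.1 ∧ τ'.1.2.1 = τ.1.2

/-- The value at `u` of a map `q = g ∘ p_{μ,α}`, as a point of the fibre of `X_μ` over `x`. -/
def PTilde.eval {μ : M.Name} (q : D.PTilde μ) {u : D.UnivCov} {x : Pt s} (hu : u.LiesOver x) :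
    Fib x.hom (M.cover μ) where
  hom := (q.1 u).hom
  w := by
    obtain ⟨α, g, -, hg⟩ := q.2
    rw [hg u]
    have h := g.w_map
    have h' := hu ⟨μ, α⟩
    rw [← h, ← Category.assoc] at h'
    exact (Category.assoc _ _ _).trans h'

end DistinguishedSystem
end Covers
end UnivCover

end

open UnivCover UnivCover.DistinguishedSystem

/-! Everything rests on rigidity (`hom_eq_of_comp_eq`): over X, two morphisms from a connected
scheme to a finite étale cover coincide once they agree at one geometric point. To apply it to the
X_{μ,α} one needs these to be connected (`connectedSpace_geom`). Here k^μ is a field, being reduced,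
connected and integral over k, and it is algebraically closed in the functions on X_μ; base change
along an algebraic extension of k^μ then creates no new idempotents.

By rigidity, whether σ preserves a given distinguished morphism depends only on the effect of σ on
one point and on its image. Points are defined over finite extensions of k, so this condition is
locally constant in σ and G^♯ is closed (`isClosed_gSharp`). By infinite Galois theory k^♯ = k then
forces G^♯ = Gal_k.

Hence every σ acts on the projective limit by (σu)_{σ(i)} = σ(u_i), and compatibility with the maps
p_μ leaves no other choice, so the automorphisms of the first structure are exactly the elements of
Gal_k. On the maps g ∘ p_{μ,α} they act by conjugation, q ↦ σ ∘ q ∘ σ⁻¹; compatibility with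
evaluation makes this the only possible extension.

Points u over x exist by compactness: the fibres of the X_{μ,α} over x are finite and nonempty, and
the X_{μ,α} form a directed system. Given u, each point y in the fibre over x of a finite étale
cover Y is h(u_i) for some morphism h : X_i → Y over X, by Galois closures and transitivity of deck
transformations. Put σ · y = h^σ(u_{σ(i)}), where h^σ is `twist σ i` followed by h. Directedness,
rigidity and G^♯ = Gal_k make this independent of i and h (`UnivCov.Moves.unique`). It is natural in
Y and multiplicative in σ, so it maps Gal_k to the étale fundamental group. It is a section because
u_{σ(i)} lies on the component where the constants are embedded by σ ∘ α
(`UnivCov.constEmb_fibAct`), continuous because stabilizers of points are open, and compatible with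
t by taking for h a deck transformation followed by the projection to X_μ (`UnivCov.fibAct_eval`).
-/

noncomputable section
namespace UnivCover

/-! ### Integral elements and idempotents in tensor products over a field -/

section Algebra

open TensorProduct

/-- If every element of `R` integral over the field `k` is a scalar, then for `S` smooth over `k`
every element of `S ⊗ R` integral over `S` comes from `S`. -/
lemma exists_eq_tmul_one_of_isIntegral {k S R : Type*} [Field k] [CommRing S] [Algebra k S]
    [Algebra.Smooth k S] [CommRing R] [Algebra k R]
    (hR : ∀ b : R, IsIntegral k b → ∃ c : k, algebraMap k R c = b)
    (z : S ⊗[k] R) (hz : IsIntegral S z) : ∃ s : S, z = s ⊗ₜ 1 := by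
  -- Integral closure commutes with smooth base change, so z comes from the tensor product of S with
  -- the integral closure of k in R, which consists of scalars.
  obtain ⟨w, hw⟩ := (TensorProduct.toIntegralClosure_bijective_of_smooth (R := k) (S := S)
    (B := R)).2 ⟨z, hz⟩
  have hw' : Algebra.TensorProduct.map (AlgHom.id S S) (integralClosure k R).val w = z :=
    congrArg Subtype.val hw
  rw [← hw']
  clear hw hw' hz z
  induction w with
  | zero => exact ⟨0, by simp⟩
  | add x y hx hy =>
    obtain ⟨a, ha⟩ := hx
    obtain ⟨b, hb⟩ := hy
    exact ⟨a + b, by rw [map_add, ha, hb, add_tmul]⟩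
  | tmul x y =>
    obtain ⟨c, hc⟩ := hR y.1 y.2
    refine ⟨c • x, ?_⟩
    change x ⊗ₜ y.1 = _
    rw [← hc, Algebra.algebraMap_eq_smul_one, tmul_smul, smul_tmul']

/-- A smooth algebra over a field is reduced. -/
lemma isReduced_of_smooth (k S : Type*) [Field k] [CommRing S] [Algebra k S]
    [Algebra.Smooth k S] : IsReduced S := by
  refine ⟨fun s hs => ?_⟩
  -- The test algebra is k[X], whose elements integral over k are constants by a degree count on p ∘
  -- b. If s is nilpotent then so is s ⊗ X, which is therefore integral over S and hence a constant
  -- polynomial; its X-coefficient s must vanish.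
  have hR : ∀ b : Polynomial k, IsIntegral k b → ∃ c : k, algebraMap k (Polynomial k) c = b := by
    intro b hb
    obtain ⟨p, hp, h⟩ := hb
    by_contra hc
    have hd : 0 < b.natDegree := by
      rw [Nat.pos_iff_ne_zero]
      intro h0
      exact hc ⟨b.coeff 0, (Polynomial.eq_C_of_natDegree_eq_zero h0).symm⟩
    have h' : p.comp b = 0 := h
    have h1 : p.natDegree * b.natDegree = 0 := by
      rw [← Polynomial.natDegree_comp, h', Polynomial.natDegree_zero]
    have h2 : p.natDegree = 0 := by
      rcases Nat.mul_eq_zero.1 h1 with h | h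
      · exact h
      · omega
    rw [Polynomial.eq_one_of_monic_natDegree_zero hp h2] at h'
    simp at h'
  have hn : IsNilpotent (s ⊗ₜ[k] (Polynomial.X : Polynomial k)) := by
    obtain ⟨n, hn⟩ := hs
    exact ⟨n, by rw [Algebra.TensorProduct.tmul_pow, hn, zero_tmul]⟩
  have hi : IsIntegral S (s ⊗ₜ[k] (Polynomial.X : Polynomial k)) := by
    obtain ⟨n, hn⟩ := hn
    exact ⟨Polynomial.X ^ n, Polynomial.monic_X_pow n, by simpa using hn⟩
  obtain ⟨a, ha⟩ := exists_eq_tmul_one_of_isIntegral hR _ hi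
  have := congrArg (TensorProduct.rid k S ∘
    (LinearMap.lTensor S (Polynomial.lcoeff k 1))) ha
  simpa [Polynomial.coeff_one] using this

/-- A reduced connected algebra that is integral over a field is a field. -/
lemma isField_of_isIntegral_of_isReduced (k : Type*) {K : Type*} [Field k] [CommRing K]
    [Algebra k K] [Nontrivial K] [IsReduced K] [Algebra.IsIntegral k K]
    (h : ∀ e : K, IsIdempotentElem e → e = 0 ∨ e = 1) : IsField K := by
  refine ⟨⟨0, 1, zero_ne_one⟩, mul_comm, fun {a} ha => ?_⟩
  obtain ⟨p, hp, hpa⟩ := Algebra.IsIntegral.isIntegral (R := k) a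
  -- Write p = X^m q with c = q(0) ≠ 0. Then a q(a) is nilpotent, hence 0, and q(a) = a r(a) + c
  -- gives q(a)² = c q(a), so q(a)/c is idempotent. If it is 0, then -r(a)/c inverts a; if it is 1,
  -- then a q(a) = 0 forces a = 0.
  obtain ⟨q, hq⟩ : ∃ q, p = Polynomial.X ^ p.rootMultiplicity 0 * q ∧ q.eval 0 ≠ 0 := by
    obtain ⟨q, hq, hq'⟩ := Polynomial.exists_eq_pow_rootMultiplicity_mul_and_not_dvd p hp.ne_zero 0
    refine ⟨q, by simpa using hq, fun h0 => hq' ?_⟩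
    exact Polynomial.dvd_iff_isRoot.2 h0
  have haq : a * Polynomial.aeval a q = 0 := by
    have h0 : a ^ p.rootMultiplicity 0 * Polynomial.aeval a q = 0 := by
      have : Polynomial.aeval a p = 0 := hpa
      rw [hq.1] at this
      simpa using this
    have h1 : (a * Polynomial.aeval a q) ^ (p.rootMultiplicity 0 + 1) = 0 := by
      rw [mul_pow, pow_succ, pow_succ]
      linear_combination (a * Polynomial.aeval a q ^ p.rootMultiplicity 0) * h0
    exact eq_zero_of_pow_eq_zero h1
  obtain ⟨r, hr⟩ : ∃ r : Polynomial k, q = Polynomial.X * r + Polynomial.C (q.eval 0) := by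
    refine ⟨q.divX, ?_⟩
    rw [← Polynomial.coeff_zero_eq_eval_zero, Polynomial.X_mul_divX_add]
  set c := q.eval 0
  have hc : algebraMap k K c * algebraMap k K c⁻¹ = 1 := by
    rw [← map_mul, mul_inv_cancel₀ hq.2, map_one]
  have hqa : Polynomial.aeval a q = a * Polynomial.aeval a r + algebraMap k K c := by
    conv_lhs => rw [hr]
    simp
  have he : IsIdempotentElem (Polynomial.aeval a q * algebraMap k K c⁻¹) := by
    unfold IsIdempotentElem
    conv_lhs => enter [2, 1]; rw [hqa]
    linear_combination (Polynomial.aeval a r * algebraMap k K c⁻¹ ^ 2) * haq +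
      (Polynomial.aeval a q * algebraMap k K c⁻¹) * hc
  rcases h _ he with h0 | h1
  · refine ⟨-(Polynomial.aeval a r * algebraMap k K c⁻¹), ?_⟩
    rw [hqa] at h0
    linear_combination hc - h0
  · exact absurd (by linear_combination (-a) * h1 + (algebraMap k K c⁻¹) * haq) ha

/-- An element of `F ⊗ R`, for an algebraic extension `F` of `K`, comes from `L ⊗ R` for a finite
extension `L` of `K` inside `F`. -/
lemma exists_finite_mem_range_map {K F R : Type*} [Field K] [Field F] [Algebra K F]
    [Algebra.IsAlgebraic K F] [CommRing R] [Algebra K R] (z : F ⊗[K] R) :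
    ∃ L : IntermediateField K F, FiniteDimensional K L ∧
      ∃ w : L ⊗[K] R, Algebra.TensorProduct.map L.val (AlgHom.id K R) w = z := by
  induction z with
  | zero => exact ⟨⊥, inferInstance, 0, map_zero _⟩
  | tmul x y =>
    refine ⟨IntermediateField.adjoin K {x}, IntermediateField.adjoin.finiteDimensional
      (Algebra.IsIntegral.isIntegral x), IntermediateField.AdjoinSimple.gen K x ⊗ₜ y, ?_⟩
    simp
  | add x y hx hy =>
    obtain ⟨L, hL, a, ha⟩ := hx
    obtain ⟨L', hL', b, hb⟩ := hy
    refine ⟨L ⊔ L', IntermediateField.finiteDimensional_sup L L',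
      Algebra.TensorProduct.map
        (IntermediateField.inclusion (le_sup_left : _ ≤ L ⊔ L')) (AlgHom.id K R) a +
      Algebra.TensorProduct.map
        (IntermediateField.inclusion (le_sup_right : _ ≤ L ⊔ L')) (AlgHom.id K R) b, ?_⟩
    rw [map_add, ← ha, ← hb]
    congr 1
    · exact congr($((Algebra.TensorProduct.map_comp (L ⊔ L').val
        (IntermediateField.inclusion (le_sup_left : _ ≤ L ⊔ L')) (AlgHom.id K R) (AlgHom.id K R)).symm) a)
    · exact congr($((Algebra.TensorProduct.map_comp (L ⊔ L').val
        (IntermediateField.inclusion (le_sup_right : _ ≤ L ⊔ L')) (AlgHom.id K R) (AlgHom.id K R)).symm) b)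

/-- If the field `K` is integrally closed in the algebra `R` then `F ⊗ R` is connected for every
algebraic extension `F` of `K`. -/
lemma eq_zero_or_one_of_isIdempotentElem_tensor {K F R : Type*} [Field K] [CharZero K] [Field F]
    [Algebra K F] [Algebra.IsAlgebraic K F] [CommRing R] [Algebra K R]
    (hR : ∀ b : R, IsIntegral K b → ∃ c : K, algebraMap K R c = b)
    (e : F ⊗[K] R) (he : IsIdempotentElem e) : e = 0 ∨ e = 1 := by
  cases subsingleton_or_nontrivial R
  · have : Subsingleton (F ⊗[K] R) := by
      refine subsingleton_of_zero_eq_one ?_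
      rw [Algebra.TensorProduct.one_def, Subsingleton.elim (1 : R) 0, tmul_zero]
    exact Or.inl (Subsingleton.elim _ _)
  -- The preceding smoothness argument applies to finite extensions, which are étale in
  -- characteristic 0. An idempotent is a root of X(X - 1), so over L it is integral, hence comes
  -- from the field L.
  obtain ⟨L, hL, w, rfl⟩ := exists_finite_mem_range_map e
  have hinj : Function.Injective (Algebra.TensorProduct.map L.val (AlgHom.id K R)) :=
    Module.Flat.rTensor_preserves_injective_linearMap (M := R) L.val.toLinearMap
      Subtype.val_injective
  have hw : IsIdempotentElem w := hinj (by rw [map_mul]; exact he)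
  have : Algebra.FormallyEtale K L := (Algebra.FormallyEtale.iff_isSeparable K L).2 inferInstance
  have : Algebra.Etale K L :=
    ⟨inferInstance, Algebra.FinitePresentation.of_finiteType.1 inferInstance⟩
  have hi : IsIntegral L w := by
    refine ⟨Polynomial.X * (Polynomial.X - Polynomial.C 1), ?_, ?_⟩
    · exact Polynomial.monic_X.mul (Polynomial.monic_X_sub_C 1)
    · simp [mul_sub, hw.eq]
  obtain ⟨a, rfl⟩ := exists_eq_tmul_one_of_isIntegral hR w hi
  have hinj' : Function.Injective (fun a : L => (a ⊗ₜ[K] (1 : R) : L ⊗[K] R)) :=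
    Algebra.TensorProduct.includeLeft_injective (S := K) (algebraMap K R).injective
  have ha : a * a = a := hinj' (by simpa [IsIdempotentElem] using hw)
  rcases IsIdempotentElem.iff_eq_zero_or_one.1 ha with rfl | rfl
  · left; simp
  · right; rw [← Algebra.TensorProduct.one_def, map_one]

end Algebra

/-! ### Connectedness, rigidity, lifting of geometric points, reducedness -/

section Schemes

/-- The global idempotents of a connected scheme are trivial. -/
lemma eq_zero_or_one_of_isIdempotentElem (Y : Scheme.{u}) [ConnectedSpace Y] (e : Γ(Y, ⊤))
    (he : IsIdempotentElem e) : e = 0 ∨ e = 1 := by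
  have h0 : e * (1 - e) = 0 := by rw [mul_sub, mul_one, he.eq, sub_self]
  have h1 : Y.basicOpen e ⊓ Y.basicOpen (1 - e) = ⊥ := by
    rw [← Scheme.basicOpen_mul, h0, Scheme.basicOpen_zero]
  have h2 : Y.basicOpen e ⊔ Y.basicOpen (1 - e) = ⊤ := by
    have := Scheme.basicOpen_add_le Y e (1 - e)
    rw [add_sub_cancel, Scheme.basicOpen_one] at this
    exact top_le_iff.1 this
  have hc : IsClopen (Y.basicOpen e : Set Y) := by
    refine ⟨?_, (Y.basicOpen e).2⟩
    have : (Y.basicOpen e : Set Y) = (Y.basicOpen (1 - e) : Set Y)ᶜ := by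
      have h1' := congrArg (SetLike.coe : Y.Opens → Set Y) h1
      have h2' := congrArg (SetLike.coe : Y.Opens → Set Y) h2
      exact (IsCompl.of_eq (by simpa using h1') (by simpa using h2')).eq_compl
    rw [this]
    exact (Y.basicOpen (1 - e)).2.isClosed_compl
  have hu : ∀ f : Γ(Y, ⊤), Y.basicOpen f = ⊤ → IsUnit f := fun f hf =>
    (RingedSpace.isUnit_of_isUnit_germ _ _ _ fun x hx => by
      have : x ∈ Y.basicOpen f := by rw [hf]; trivial
      exact (Scheme.mem_basicOpen _ _ _ hx).1 this)
  rcases isClopen_iff.1 hc with h | h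
  · left
    have h3 : Y.basicOpen (1 - e) = ⊤ := by
      have : Y.basicOpen e = ⊥ := SetLike.coe_injective h
      rwa [this, bot_sup_eq] at h2
    exact (hu _ h3).mul_left_eq_zero.1 h0
  · right
    have h3 := hu e (SetLike.coe_injective h)
    exact (sub_eq_zero.1 (h3.mul_right_eq_zero.1 h0)).symm

/-- A nonempty scheme with only the trivial global idempotents is connected. -/
lemma connectedSpace_of_isIdempotentElem (Y : Scheme.{u}) [Nonempty Y]
    (h : ∀ e : Γ(Y, ⊤), IsIdempotentElem e → e = 0 ∨ e = 1) : ConnectedSpace Y := by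
  -- The product decomposition below concerns sections over `U ⊔ V`, which equals `⊤` only
  -- propositionally; hence the variable W.
  have h' : ∀ W : Y.Opens, W = ⊤ → ∀ e : Γ(Y, W), IsIdempotentElem e → e = 0 ∨ e = 1 := by
    rintro _ rfl
    exact h
  have : PreconnectedSpace Y := by
    refine preconnectedSpace_iff_clopen.2 fun s hs => ?_
    let U : Y.Opens := ⟨s, hs.2⟩
    let V : Y.Opens := ⟨sᶜ, hs.1.isOpen_compl⟩
    have hUV : U ⊔ V = ⊤ := SetLike.coe_injective (Set.union_compl_self s)
    let e : Γ(Y, U ⊔ V) ≅ CommRingCat.of (Γ(Y, U) × Γ(Y, V)) :=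
      (Y.sheaf.isProductOfDisjoint U V (SetLike.coe_injective
        (Set.inter_compl_self s))).conePointUniqueUpToIso (CommRingCat.prodFanIsLimit _ _)
    let e' : Γ(Y, U ⊔ V) ≃+* Γ(Y, U) × Γ(Y, V) := e.commRingCatIsoToRingEquiv
    have hid : IsIdempotentElem (e'.symm (1, 0)) := by
      unfold IsIdempotentElem
      rw [← map_mul]
      simp
    by_contra! hne
    have : Nonempty U := Set.Nonempty.to_subtype hne.1
    have : Nonempty V := Set.Nonempty.to_subtype (Set.nonempty_compl.2 hne.2)
    rcases h' _ hUV _ hid with h0 | h1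
    · rw [map_eq_zero_iff _ e'.symm.injective] at h0
      exact one_ne_zero (congrArg Prod.fst h0)
    · rw [map_eq_one_iff _ e'.symm.injective] at h1
      exact zero_ne_one (congrArg Prod.snd h1)
  exact ⟨inferInstance⟩

/-- An open and closed immersion from a nonempty scheme to a connected scheme is an isomorphism. -/
lemma isIso_of_isOpenImmersion_of_isClosedImmersion {A B : Scheme.{u}} (f : A ⟶ B)
    [IsOpenImmersion f] [IsClosedImmersion f] [Nonempty A] [ConnectedSpace B] : IsIso f := by
  have : Surjective f := by
    refine ⟨Set.range_eq_univ.1 ?_⟩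
    exact IsClopen.eq_univ ⟨f.isClosedEmbedding.isClosed_range, f.isOpenEmbedding.isOpen_range⟩
      (Set.range_nonempty _)
  exact IsOpenImmersion.isIso f

/-- Rigidity: two morphisms over `X` from a connected scheme to an étale separated scheme over `X`
are equal if they agree at a geometric point. -/
lemma hom_eq_of_comp_eq {X T Y P : Scheme.{u}} (p : Y ⟶ X) [Etale p] [IsSeparated p]
    [ConnectedSpace T] [Nonempty P] (f g : T ⟶ Y) (h : f ≫ p = g ≫ p) (a : P ⟶ T)
    (ha : a ≫ f = a ≫ g) : f = g := by
  let fg : T ⟶ pullback.diagonalObj p := pullback.lift f g h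
  have hf : fg ≫ pullback.fst p p = f := pullback.lift_fst _ _ _
  have hg : fg ≫ pullback.snd p p = g := pullback.lift_snd _ _ _
  -- This is the equalizer of f and g. The diagonal of p is an open immersion because p is étale and
  -- a closed one because p is separated, so the equalizer is open and closed in T; the point a
  -- makes it nonempty.
  let i := pullback.snd (pullback.diagonal p) fg
  have : IsOpenImmersion i := inferInstance
  have : IsClosedImmersion i := inferInstance
  have hab : (a ≫ f) ≫ pullback.diagonal p = a ≫ fg := by
    apply pullback.hom_ext
    · rw [Category.assoc, pullback.diagonal_fst, Category.comp_id, Category.assoc, hf]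
    · rw [Category.assoc, pullback.diagonal_snd, Category.comp_id, Category.assoc, hg, ha]
  let b : P ⟶ pullback (pullback.diagonal p) fg := pullback.lift (a ≫ f) a hab
  have : Nonempty (pullback (pullback.diagonal p) fg : Scheme.{u}) := ⟨b (Classical.arbitrary P)⟩
  have : IsIso i := isIso_of_isOpenImmersion_of_isClosedImmersion i
  have hc : i ≫ fg = pullback.fst _ _ ≫ pullback.diagonal p := pullback.condition.symm
  have h1 : i ≫ f = pullback.fst (pullback.diagonal p) fg := by
    rw [← hf, ← Category.assoc, hc, Category.assoc, pullback.diagonal_fst, Category.comp_id]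
  have h2 : i ≫ g = pullback.fst (pullback.diagonal p) fg := by
    rw [← hg, ← Category.assoc, hc, Category.assoc, pullback.diagonal_snd, Category.comp_id]
  exact (cancel_epi i).1 (h1.trans h2.symm)

/-- A finite étale morphism from a nonempty scheme to a connected scheme is surjective. -/
lemma surjective_of_isFinite_of_etale {A B : Scheme.{u}} (p : A ⟶ B) [IsFinite p] [Etale p]
    [Nonempty A] [ConnectedSpace B] : Surjective p := by
  refine ⟨Set.range_eq_univ.1 ?_⟩
  exact IsClopen.eq_univ ⟨p.isClosedMap.isClosed_range, p.isOpenMap.isOpen_range⟩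
    (Set.range_nonempty _)

/-- A nonempty scheme locally of finite type over an algebraically closed field has a rational
point. -/
lemma exists_section_of_isAlgClosed {K : Type u} [Field K] [IsAlgClosed K] {A : Scheme.{u}}
    [Nonempty A] (p : A ⟶ Spec (CommRingCat.of K)) [LocallyOfFiniteType p] :
    ∃ a : Spec (CommRingCat.of K) ⟶ A, a ≫ p = 𝟙 _ := by
  have : JacobsonSpace A := LocallyOfFiniteType.jacobsonSpace p
  obtain ⟨x, -, hx⟩ := nonempty_inter_closedPoints (Set.univ_nonempty (α := A))
    isOpen_univ.isLocallyClosed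
  exact ⟨pointOfClosedPoint p x hx, pointOfClosedPoint_comp p x hx⟩

/-- Geometric points lift along surjective morphisms locally of finite type. -/
lemma exists_lift_of_surjective {K : Type u} [Field K] [IsAlgClosed K] {A B : Scheme.{u}}
    (p : A ⟶ B) [LocallyOfFiniteType p] [Surjective p] (b : Spec (CommRingCat.of K) ⟶ B) :
    ∃ a : Spec (CommRingCat.of K) ⟶ A, a ≫ p = b := by
  have : Surjective (pullback.snd p b) := inferInstance
  have : Nonempty (pullback p b : Scheme.{u}) :=
    ⟨((pullback.snd p b).surjective (IsLocalRing.closedPoint K)).choose⟩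
  obtain ⟨a, ha⟩ := exists_section_of_isAlgClosed (pullback.snd p b)
  exact ⟨a ≫ pullback.fst p b, by
    rw [Category.assoc, pullback.condition, ← Category.assoc, ha, Category.id_comp]⟩

/-- A scheme smooth over a field is reduced. -/
lemma isReduced_of_smooth_spec {k : Type u} [Field k] {Y : Scheme.{u}}
    (t : Y ⟶ Spec (CommRingCat.of k)) [Smooth t] : IsReduced Y := by
  have key : ∀ (R : CommRingCat.{u}) (j : Spec R ⟶ Y), IsOpenImmersion j →
      IsReduced (Spec R) := by
    intro R j hj
    obtain ⟨φ, hφ⟩ := Spec.map_surjective (j ≫ t)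
    have hs : Smooth (Spec.map φ) := by rw [hφ]; infer_instance
    rw [HasRingHomProperty.Spec_iff (P := @Smooth)] at hs
    algebraize [φ.hom]
    have := isReduced_of_smooth k R
    infer_instance
  have : ∀ i, IsReduced (Y.affineCover.X i) := fun i => key _ _ (Y.affineCover.map_prop i)
  exact IsReduced.of_openCover _ Y.affineCover

end Schemes

/-! ### Fields of definition of points and open stabilizers -/

section Stabilizers

variable {k : Type u} [Field k]

/-- A `k^alg`-point of a scheme locally of finite type over `k` is defined over a finite extension
of `k`. -/
lemma exists_finite_smul_eq {Y : Scheme.{u}} (t : Y ⟶ Spec (CommRingCat.of k))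
    [LocallyOfFiniteType t] (y : Pt t) :
    ∃ E : IntermediateField k (AlgebraicClosure k), FiniteDimensional k E ∧
      ∀ σ : GalK k, σ ∈ E.fixingSubgroup → σ • y = y := by
  obtain ⟨R, j, hj, hyj, -⟩ := Y.exists_affine_mem_range_and_range_subset
    (x := y.hom (IsLocalRing.closedPoint _)) (U := ⊤) trivial
  have hrange : Set.range y.hom ⊆ Set.range j := by
    rintro _ ⟨z, rfl⟩
    rwa [Subsingleton.elim z (IsLocalRing.closedPoint _)]
  obtain ⟨ψ, hψ⟩ := Spec.map_surjective (IsOpenImmersion.lift j y.hom hrange)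
  obtain ⟨φ, hφ⟩ := Spec.map_surjective (j ≫ t)
  have ht : LocallyOfFiniteType (Spec.map φ) := by rw [hφ]; infer_instance
  rw [HasRingHomProperty.Spec_iff (P := @LocallyOfFiniteType)] at ht
  have hy : y.hom = Spec.map ψ ≫ j := by rw [hψ, IsOpenImmersion.lift_fac]
  have hφψ : φ ≫ ψ = CommRingCat.ofHom (algebraMap k (AlgebraicClosure k)) := by
    apply Spec.map_injective
    rw [Spec.map_comp, hφ, ← Category.assoc, ← hy, y.w]
  algebraize [φ.hom]
  let ψ' : R →ₐ[k] AlgebraicClosure k :=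
    { ψ.hom with commutes' := fun a => congr($hφψ a) }
  obtain ⟨S, hS⟩ := Algebra.FiniteType.out (R := k) (A := R)
  -- E is generated by the coordinates of the point in an affine chart of finite type.
  refine ⟨IntermediateField.adjoin k (ψ' '' S),
    IntermediateField.finiteDimensional_adjoin fun x _ => Algebra.IsIntegral.isIntegral x,
    fun σ hσ => ?_⟩
  have h : (σ : AlgebraicClosure k →ₐ[k] AlgebraicClosure k).comp ψ' = ψ' := by
    refine AlgHom.ext_of_adjoin_eq_top hS fun a ha => ?_
    exact (IntermediateField.mem_fixingSubgroup_iff _ _).1 hσ _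
      (IntermediateField.subset_adjoin _ _ ⟨a, ha, rfl⟩)
  refine Pt.ext ?_
  rw [Pt.smul_hom, hy, ← Category.assoc]
  congr 1
  change Spec.map _ ≫ Spec.map ψ = Spec.map ψ
  rw [← Spec.map_comp]
  congr 1
  ext a
  exact congr($h a)

/-- The stabilizers of `k^alg`-points are open. -/
lemma isOpen_stabilizer {Y : Scheme.{u}} (t : Y ⟶ Spec (CommRingCat.of k))
    [LocallyOfFiniteType t] (y : Pt t) :
    IsOpen (MulAction.stabilizer (GalK k) y : Set (GalK k)) := by
  obtain ⟨E, hE, h⟩ := exists_finite_smul_eq t y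
  exact Subgroup.isOpen_mono (H₁ := E.fixingSubgroup) h
    (IntermediateField.fixingSubgroup_isOpen E)

end Stabilizers

/-! ### Components, products and powers of finite étale covers -/

section FiniteEtaleCovers

variable {k : Type u} [Field k] {X : Scheme.{u}}

instance (Y : FEt X) : IsFinite Y.obj.hom := Y.property.1

instance (Y : FEt X) : Etale Y.obj.hom := Y.property.2

/-- The finite étale cover given by a finite étale morphism. -/
def FEt.mk {T : Scheme.{u}} (p : T ⟶ X) [hp : IsFinite p] [hp' : Etale p] : FEt X where
  obj := Over.mk p
  property := ⟨hp, hp'⟩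

/-- The morphism of finite étale covers given by a morphism over `X`. -/
def FEt.homMk {Y Z : FEt X} (f : Y.obj.left ⟶ Z.obj.left) (h : f ≫ Z.obj.hom = Y.obj.hom) : Y ⟶ Z :=
  ObjectProperty.homMk (Over.homMk f h)

lemma FEt.homMk_left {Y Z : FEt X} (f : Y.obj.left ⟶ Z.obj.left) (h : f ≫ Z.obj.hom = Y.obj.hom) :
    (FEt.homMk f h).hom.left = f := rfl

lemma FEt.w {Y Z : FEt X} (f : Y ⟶ Z) : f.hom.left ≫ Z.obj.hom = Y.obj.hom := Over.w f.hom

lemma FEt.comp_left {Y Z W : FEt X} (f : Y ⟶ Z) (g : Z ⟶ W) :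
    (f ≫ g).hom.left = f.hom.left ≫ g.hom.left := rfl

lemma FEt.hom_ext {Y Z : FEt X} {f g : Y ⟶ Z} (h : f.hom.left = g.hom.left) : f = g :=
  ObjectProperty.hom_ext _ (Over.OverMorphism.ext h)

instance {Y Z : FEt X} (f : Y ⟶ Z) : IsFinite f.hom.left := by
  have : IsFinite (f.hom.left ≫ Z.obj.hom) := by rw [FEt.w]; infer_instance
  exact IsFinite.of_comp f.hom.left Z.obj.hom

instance {Y Z : FEt X} (f : Y ⟶ Z) : Etale f.hom.left := by
  have : Etale (f.hom.left ≫ Z.obj.hom) := by rw [FEt.w]; infer_instance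
  exact Etale.of_comp f.hom.left Z.obj.hom

variable {x : SpecBar k ⟶ X}

lemma fibreFunctor_map_comp {Y Z W : FEt X} (f : Y ⟶ Z) (g : Z ⟶ W) (y : Fib x Y) :
    (fibreFunctor x).map (f ≫ g) y = (fibreFunctor x).map g ((fibreFunctor x).map f y) :=
  Fib.ext (Category.assoc _ _ _).symm

lemma fibreFunctor_map_id {Y : FEt X} (y : Fib x Y) : (fibreFunctor x).map (𝟙 Y) y = y :=
  Fib.ext (Category.comp_id _)

/-- Morphisms from a connected cover are determined by the image of a geometric point. -/
lemma FEt.hom_eq_of_map_eq {Y Z : FEt X} [ConnectedSpace Y.obj.left] {f g : Y ⟶ Z} (y : Fib x Y)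
    (h : (fibreFunctor x).map f y = (fibreFunctor x).map g y) : f = g :=
  FEt.hom_ext (hom_eq_of_comp_eq Z.obj.hom _ _ ((FEt.w f).trans (FEt.w g).symm) y.hom
    (congrArg Fib.hom h))

/-- Morphisms from a nonempty cover to a connected cover are surjective on geometric fibres. -/
lemma FEt.map_surjective {Y Z : FEt X} [Nonempty Y.obj.left] [ConnectedSpace Z.obj.left]
    (f : Y ⟶ Z) (z : Fib x Z) : ∃ y : Fib x Y, (fibreFunctor x).map f y = z := by
  have := surjective_of_isFinite_of_etale f.hom.left
  obtain ⟨a, ha⟩ := exists_lift_of_surjective f.hom.left z.hom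
  exact ⟨⟨a, by rw [← FEt.w f, ← Category.assoc, ha, z.w]⟩, Fib.ext ha⟩

/-- A morphism from a connected scheme factors through an open and closed subscheme if a point
does. -/
lemma exists_factor_of_isOpenImmersion_of_isClosedImmersion {T Y Z P : Scheme.{u}} [Nonempty P]
    [ConnectedSpace T] (j : Z ⟶ Y) [IsOpenImmersion j] [IsClosedImmersion j] (g : T ⟶ Y)
    (a : P ⟶ T) (b : P ⟶ Z) (h : b ≫ j = a ≫ g) : ∃ l : T ⟶ Z, l ≫ j = g := by
  have hc : IsClopen (g ⁻¹' Set.range j) :=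
    IsClopen.preimage ⟨j.isClosedEmbedding.isClosed_range, j.isOpenEmbedding.isOpen_range⟩
      g.continuous
  have hne : (g ⁻¹' Set.range j).Nonempty := by
    let p := Classical.arbitrary P
    refine ⟨a p, b p, ?_⟩
    rw [← Scheme.Hom.comp_apply, h, Scheme.Hom.comp_apply]
  have hr : Set.range g ⊆ Set.range j := by
    rintro _ ⟨t, rfl⟩
    have : t ∈ g ⁻¹' Set.range j := by rw [hc.eq_univ hne]; trivial
    exact this
  exact ⟨IsOpenImmersion.lift j g hr, IsOpenImmersion.lift_fac j g hr⟩

/-- The connected component of a geometric point of a finite étale cover. -/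
lemma FEt.exists_component [ConnectedSpace X] (Y : FEt X) (y : Fib x Y) :
    ∃ (Z : FEt X) (j : Z ⟶ Y) (z : Fib x Z), ConnectedSpace Z.obj.left ∧
      IsOpenImmersion j.hom.left ∧ IsClosedImmersion j.hom.left ∧ (fibreFunctor x).map j z = y := by
  -- Each component of Y is mapped onto the connected base, so it meets the finite fibre over x.
  -- Finiteness of the set of components is what makes a component open.
  have hfin : Finite (_root_.ConnectedComponents Y.obj.left) :=
    IsOpenMap.finite_connectedComponents_of_finite_preimage_singleton_of_connectedSpace
      Y.obj.hom.isOpenMap Y.obj.hom.isClosedMap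
      (y := x (IsLocalRing.closedPoint _)) (Y.obj.hom.finite_preimage_singleton _)
  let y₀ := y.hom (IsLocalRing.closedPoint _)
  have ho : IsOpen (connectedComponent y₀) := by
    rw [← connectedComponents_preimage_singleton]
    exact (isOpen_discrete _).preimage ConnectedComponents.continuous_coe
  let U : Y.obj.left.Opens := ⟨connectedComponent y₀, ho⟩
  have hUo : IsOpenImmersion U.ι := inferInstance
  have hU : IsClosedImmersion U.ι := by
    refine IsClosedImmersion.of_isPreimmersion _ ?_
    rw [Scheme.Opens.range_ι]
    exact isClosed_connectedComponent
  have h1 : IsFinite (U.ι ≫ Y.obj.hom) := inferInstance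
  have h2 : Etale (U.ι ≫ Y.obj.hom) := inferInstance
  have hr : Set.range y.hom ⊆ Set.range U.ι := by
    rw [Scheme.Opens.range_ι]
    rintro _ ⟨t, rfl⟩
    rw [Subsingleton.elim t (IsLocalRing.closedPoint _)]
    exact mem_connectedComponent
  have hl := IsOpenImmersion.lift_fac U.ι y.hom hr
  set l := IsOpenImmersion.lift U.ι y.hom hr
  refine ⟨FEt.mk (U.ι ≫ Y.obj.hom), FEt.homMk U.ι rfl, ⟨l, ?_⟩, ?_, hUo, hU, Fib.ext hl⟩
  · change _ ≫ U.ι ≫ _ = _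
    rw [← Category.assoc, hl, y.w]
  · exact isConnected_iff_connectedSpace.1 isConnected_connectedComponent

/-- The fibre product of two finite étale covers. -/
def FEt.prod (Y Z : FEt X) : FEt X := FEt.mk (pullback.fst Y.obj.hom Z.obj.hom ≫ Y.obj.hom)

/-- The first projection of a fibre product. -/
def FEt.fst (Y Z : FEt X) : FEt.prod Y Z ⟶ Y := FEt.homMk (pullback.fst Y.obj.hom Z.obj.hom) rfl

/-- The second projection of a fibre product. -/
def FEt.snd (Y Z : FEt X) : FEt.prod Y Z ⟶ Z :=
  FEt.homMk (pullback.snd Y.obj.hom Z.obj.hom) pullback.condition.symm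

lemma FEt.prod_lift {Y Z : FEt X} {T : Scheme.{u}} (f : T ⟶ Y.obj.left) (g : T ⟶ Z.obj.left)
    (h : f ≫ Y.obj.hom = g ≫ Z.obj.hom) : ∃ l : T ⟶ (FEt.prod Y Z).obj.left,
      l ≫ (FEt.fst Y Z).hom.left = f ∧ l ≫ (FEt.snd Y Z).hom.left = g :=
  ⟨pullback.lift f g h, pullback.lift_fst _ _ _, pullback.lift_snd _ _ _⟩

lemma FEt.prod_ext {Y Z : FEt X} {T : Scheme.{u}} {f g : T ⟶ (FEt.prod Y Z).obj.left}
    (h₁ : f ≫ (FEt.fst Y Z).hom.left = g ≫ (FEt.fst Y Z).hom.left)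
    (h₂ : f ≫ (FEt.snd Y Z).hom.left = g ≫ (FEt.snd Y Z).hom.left) : f = g :=
  pullback.hom_ext h₁ h₂

lemma FEt.exists_prod_point {Y Z : FEt X} (y : Fib x Y) (z : Fib x Z) :
    ∃ p : Fib x (FEt.prod Y Z), (fibreFunctor x).map (FEt.fst Y Z) p = y ∧
      (fibreFunctor x).map (FEt.snd Y Z) p = z := by
  obtain ⟨l, h₁, h₂⟩ := FEt.prod_lift y.hom z.hom (y.w.trans z.w.symm)
  exact ⟨⟨l, by rw [← FEt.w (FEt.fst Y Z), ← Category.assoc, h₁, y.w]⟩, Fib.ext h₁, Fib.ext h₂⟩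

/-- The finite powers of a finite étale cover. -/
lemma FEt.exists_pow (Y : FEt X) (n : ℕ) : ∃ (P : FEt X) (π : Fin n → (P ⟶ Y)),
    (∀ (T : Scheme.{u}) (t : T ⟶ X) (g : Fin n → (T ⟶ Y.obj.left)),
      (∀ i, g i ≫ Y.obj.hom = t) →
        ∃ l : T ⟶ P.obj.left, l ≫ P.obj.hom = t ∧ ∀ i, l ≫ (π i).hom.left = g i) ∧
    ∀ (T : Scheme.{u}) (f g : T ⟶ P.obj.left), f ≫ P.obj.hom = g ≫ P.obj.hom →
      (∀ i, f ≫ (π i).hom.left = g ≫ (π i).hom.left) → f = g := by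
  induction n with
  | zero =>
    refine ⟨FEt.mk (𝟙 X), Fin.elim0, fun T t g _ => ⟨t, Category.comp_id t, fun i => i.elim0⟩,
      fun T f g h _ => ?_⟩
    exact (Category.comp_id f).symm.trans (h.trans (Category.comp_id g))
  | succ n ih =>
    obtain ⟨P, π, hP, hP'⟩ := ih
    refine ⟨FEt.prod Y P, Fin.cons (FEt.fst Y P) fun i => FEt.snd Y P ≫ π i,
      fun T t g hg => ?_, fun T f g h hfg => ?_⟩
    · obtain ⟨l, hl, hl'⟩ := hP T t (fun i => g i.succ) fun i => hg i.succ
      obtain ⟨m, h₁, h₂⟩ := FEt.prod_lift (g 0) l ((hg 0).trans hl.symm)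
      refine ⟨m, by rw [← FEt.w (FEt.fst Y P), ← Category.assoc, h₁, hg], fun i => ?_⟩
      refine Fin.cases h₁ (fun i => ?_) i
      rw [Fin.cons_succ, FEt.comp_left, ← Category.assoc, h₂, hl']
    · refine FEt.prod_ext (hfg 0) (hP' T _ _ ?_ fun i => ?_)
      · rw [Category.assoc, Category.assoc, FEt.w]
        exact h
      · have := hfg i.succ
        rw [Fin.cons_succ, FEt.comp_left] at this
        rw [Category.assoc, Category.assoc]
        exact this

end FiniteEtaleCovers

/-! ### Galois closures of pointed covers -/

section GaloisClosure

variable {k : Type u} [Field k] {X : Scheme.{u}} {s : X ⟶ Spec (CommRingCat.of k)}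

/-- A connected cover is Galois if its endomorphisms move a geometric point to all other points
of its fibre. -/
lemma isGaloisCover_of_forall_exists [ConnectedSpace X] {x : SpecBar k ⟶ X} (Z : FEt X)
    [hZ : ConnectedSpace Z.obj.left] (z : Fib x Z)
    (h : ∀ z' : Fib x Z, ∃ g : Z ⟶ Z, (fibreFunctor x).map g z = z') : IsGaloisCover s Z := by
  -- Choose z' with g(z') = z, and g' with g'(z) = z'. Then g' followed by g fixes z and is the
  -- identity by rigidity. Applying this twice makes every endomorphism invertible.
  have hl : ∀ g : Z ⟶ Z, ∃ g' : Z ⟶ Z, g' ≫ g = 𝟙 Z := by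
    intro g
    obtain ⟨z', hz'⟩ := FEt.map_surjective g z
    obtain ⟨g', hg'⟩ := h z'
    refine ⟨g', FEt.hom_eq_of_map_eq z ?_⟩
    rw [fibreFunctor_map_comp, hg', hz', fibreFunctor_map_id]
  refine ⟨hZ, fun x' a b => ?_⟩
  -- Transitivity is transported from x to another point x' through the component C of (a, b) in Z ×
  -- Z: it has a point c₀ over x with first coordinate z, and the g that takes z to the second
  -- coordinate of c₀ carries the first projection of C to the second everywhere, in particular a to
  -- b.
  obtain ⟨p, hpa, hpb⟩ := FEt.exists_prod_point a b
  obtain ⟨C, j, c, hC, -, -, hc⟩ := FEt.exists_component _ p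
  obtain ⟨c₀, hc₀⟩ := FEt.map_surjective (j ≫ FEt.fst Z Z) z
  obtain ⟨g, hg⟩ := h ((fibreFunctor x).map (j ≫ FEt.snd Z Z) c₀)
  obtain ⟨g', hg'⟩ := hl g
  obtain ⟨g'', hg''⟩ := hl g'
  have : g = g'' := by
    rw [← Category.id_comp g, ← hg'', Category.assoc, hg', Category.comp_id]
  subst this
  refine ⟨⟨g, g', hg'', hg'⟩, ?_⟩
  have heq : (j ≫ FEt.fst Z Z) ≫ g = j ≫ FEt.snd Z Z := by
    refine FEt.hom_eq_of_map_eq c₀ ?_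
    rw [fibreFunctor_map_comp, hc₀, hg]
  have h1 : (fibreFunctor x'.hom).map (j ≫ FEt.fst Z Z) c = a := by
    rw [fibreFunctor_map_comp, hc, hpa]
  have h2 : (fibreFunctor x'.hom).map (j ≫ FEt.snd Z Z) c = b := by
    rw [fibreFunctor_map_comp, hc, hpb]
  rw [← h1, ← h2, ← heq, fibreFunctor_map_comp (j ≫ FEt.fst Z Z) g]

/-- A pointed finite étale cover is dominated by a pointed Galois cover. -/
lemma exists_isGaloisCover [ConnectedSpace X] {x : SpecBar k ⟶ X} (Y : FEt X) (y : Fib x Y) :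
    ∃ Z : FEt X, IsGaloisCover s Z ∧
      ∃ (f : Z ⟶ Y) (z : Fib x Z), (fibreFunctor x).map f z = y := by
  obtain ⟨n, ⟨e⟩⟩ := Finite.exists_equiv_fin (Fib x Y)
  obtain ⟨P, π, hP, hP'⟩ := FEt.exists_pow Y n
  -- The coordinates of p list the whole fibre of Y over x; the component of p in the n-th power is
  -- the Galois closure.
  obtain ⟨p, hp, hp'⟩ := hP _ x (fun i => (e.symm i).hom) fun i => (e.symm i).w
  obtain ⟨Z, j, z, hZ, hj, hj', hz⟩ := FEt.exists_component P ⟨p, hp⟩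
  have hz' : ∀ i, (fibreFunctor x).map (j ≫ π i) z = e.symm i := fun i => by
    rw [fibreFunctor_map_comp, hz]
    exact Fib.ext (hp' i)
  refine ⟨Z, isGaloisCover_of_forall_exists Z z fun a => ?_, j ≫ π (e y), z, ?_⟩
  -- Since z lists the whole fibre, each coordinate of a is the coordinate of z with index τ i.
  -- Reindexing coordinates by τ takes z to a, and the resulting morphism lands in Z because a does.
  -- That τ is a permutation is not needed.
  · let τ : Fin n → Fin n := fun i => e ((fibreFunctor x).map (j ≫ π i) a)
    obtain ⟨l, hl, hl'⟩ := hP _ Z.obj.hom (fun i => (j ≫ π (τ i)).hom.left) fun i => FEt.w _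
    have hza : a.hom ≫ j.hom.left = z.hom ≫ l := by
      refine hP' _ _ _ ?_ fun i => ?_
      · rw [Category.assoc, Category.assoc, hl, FEt.w, a.w, z.w]
      · rw [Category.assoc, Category.assoc, hl', ← fibreFunctor_map_hom (j ≫ π (τ i)) z, hz']
        exact (congrArg Fib.hom (e.symm_apply_apply ((fibreFunctor x).map (j ≫ π i) a))).symm
    obtain ⟨g, hg⟩ := exists_factor_of_isOpenImmersion_of_isClosedImmersion j.hom.left l z.hom
      a.hom hza
    refine ⟨FEt.homMk g ?_, Fib.ext ?_⟩
    · rw [← FEt.w j, ← Category.assoc, hg, hl, FEt.w]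
    · refine (cancel_mono j.hom.left).1 ?_
      rw [fibreFunctor_map_hom, FEt.homMk_left, Category.assoc, hg, hza]
  · rw [hz', Equiv.symm_apply_apply]

end GaloisClosure

/-! ### The field of constant functions -/

section Constants

variable {k : Type u} [Field k]

instance (Y : Scheme.{u}) (t : Y ⟶ Spec (CommRingCat.of k)) :
    Algebra.IsIntegral k (ConstFn t) := inferInstance

/-- Morphisms to spectra of integral `k`-algebras factor through the constant functions. -/
lemma exists_toConst_factor {Y : Scheme.{u}} (t : Y ⟶ Spec (CommRingCat.of k)) {B : Type u}
    [CommRing B] [Algebra k B] [Algebra.IsIntegral k B] (m : Y ⟶ Spec (CommRingCat.of B))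
    (hm : m ≫ specHom (algebraMap k B) = t) :
    ∃ ψ : B →ₐ[k] ConstFn t, toConst t ≫ specHom (ψ : B →+* ConstFn t) = m := by
  let φ : B →+* Γ(Y, ⊤) := m.appTop.hom.comp (Scheme.ΓSpecIso (CommRingCat.of B)).inv.hom
  let φ' : B →ₐ[k] GlobalFn t :=
    { toRingHom := φ
      commutes' := fun a => by
        change m.appTop.hom ((Scheme.ΓSpecIso (CommRingCat.of B)).inv.hom (algebraMap k B a)) =
          t.appTop.hom ((Scheme.ΓSpecIso (CommRingCat.of k)).inv.hom a)
        have h := congr($(Scheme.ΓSpecIso_inv_naturality (CommRingCat.ofHom (algebraMap k B))) a)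
        have h' : (Scheme.ΓSpecIso (CommRingCat.of B)).inv.hom (algebraMap k B a) =
          (specHom (algebraMap k B)).appTop.hom
            ((Scheme.ΓSpecIso (CommRingCat.of k)).inv.hom a) := h
        rw [h', ← hm, Scheme.Hom.comp_appTop]
        rfl }
  let ψ : B →ₐ[k] ConstFn t := φ'.codRestrict (ConstFn t) fun b =>
    (Algebra.IsIntegral.isIntegral (R := k) b).map φ'
  refine ⟨ψ, ?_⟩
  rw [toConst, Category.assoc, ← Spec.map_comp]
  have h : CommRingCat.ofHom (ψ : B →+* ConstFn t) ≫ CommRingCat.ofHom (R := ConstFn t)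
      (S := Γ(Y, ⊤)) ((ConstFn t).val : ConstFn t →+* GlobalFn t) =
      (Scheme.ΓSpecIso (CommRingCat.of B)).inv ≫ m.appTop := rfl
  rw [h, Spec.map_comp, ← Category.assoc, ← Scheme.toSpecΓ_naturality, Category.assoc]
  simp

/-- The embedding of the constant functions given by a `k^alg`-point. -/
def Pt.emb {Y : Scheme.{u}} {t : Y ⟶ Spec (CommRingCat.of k)} (y : Pt t) :
    ConstFn t →ₐ[k] AlgebraicClosure k :=
  { (Spec.preimage (y.hom ≫ toConst t)).hom with
    commutes' := fun a => by
      have h : (CommRingCat.ofHom (algebraMap k (ConstFn t))) ≫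
          Spec.preimage (y.hom ≫ toConst t) =
          CommRingCat.ofHom (algebraMap k (AlgebraicClosure k)) := by
        apply Spec.map_injective
        rw [Spec.map_comp, Spec.map_preimage, Category.assoc, toConst_comp, y.w]
      exact congr($(h) a) }

lemma Pt.specHom_emb {Y : Scheme.{u}} {t : Y ⟶ Spec (CommRingCat.of k)} (y : Pt t) :
    specHom (y.emb : ConstFn t →+* AlgebraicClosure k) = y.hom ≫ toConst t :=
  Spec.map_preimage _

lemma algHom_eq_of_specHom_eq {A B : Type u} [CommRing A] [CommRing B] [Algebra k A] [Algebra k B]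
    {f g : A →ₐ[k] B} (h : specHom (f : A →+* B) = specHom (g : A →+* B)) : f = g :=
  AlgHom.coe_ringHom_injective (specHom_injective h)

lemma Pt.emb_smul {Y : Scheme.{u}} {t : Y ⟶ Spec (CommRingCat.of k)} (σ : GalK k) (y : Pt t) :
    (σ • y).emb = (σ : AlgebraicClosure k →ₐ[k] AlgebraicClosure k).comp y.emb := by
  refine algHom_eq_of_specHom_eq ?_
  rw [Pt.specHom_emb, Pt.smul_hom, Category.assoc, ← Pt.specHom_emb, ← Spec.map_comp]
  rfl

/-- The constant functions on a smooth connected `k`-scheme form a field. -/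
lemma isField_constFn {Y : Scheme.{u}} (t : Y ⟶ Spec (CommRingCat.of k)) [Smooth t]
    [ConnectedSpace Y] : IsField (ConstFn t) := by
  have := isReduced_of_smooth_spec t
  have h1 : _root_.IsReduced (GlobalFn t) := inferInstanceAs (_root_.IsReduced Γ(Y, ⊤))
  have : Nonempty (⊤ : Y.Opens) := ⟨⟨Classical.arbitrary Y, trivial⟩⟩
  have h2 : Nontrivial (GlobalFn t) := inferInstanceAs (Nontrivial Γ(Y, ⊤))
  have h3 : _root_.IsReduced (ConstFn t) :=
    isReduced_of_injective (ConstFn t).val Subtype.val_injective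
  refine isField_of_isIntegral_of_isReduced k fun e he => ?_
  have he' : IsIdempotentElem (M := Γ(Y, ⊤)) e.1 := congrArg Subtype.val he
  rcases eq_zero_or_one_of_isIdempotentElem Y e.1 he' with h | h
  · exact Or.inl (Subtype.ext h)
  · exact Or.inr (Subtype.ext h)

end Constants

/-! ### Connectedness after algebraic extension of the constants -/

section GeometricConnectedness

open TensorProduct

lemma flat_specHom {K F : Type u} [Field K] [Field F] (α : K →+* F) : Flat (specHom α) := by
  rw [Flat.SpecMap_iff]
  algebraize [α]
  change RingHom.Flat α
  exact (inferInstanceAs (Module.Flat K F))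

lemma surjective_specHom {K F : Type u} [Field K] [Field F] (α : K →+* F) :
    Surjective (specHom α) :=
  ⟨fun _ => ⟨IsLocalRing.closedPoint F, Subsingleton.elim (α := PrimeSpectrum K) _ _⟩⟩

/-- Flat base change for global functions. -/
lemma isPushout_globalSections_pullback {K F : Type u} [Field K] [Field F] (α : K →+* F)
    {Y : Scheme.{u}} [CompactSpace Y] [QuasiSeparatedSpace Y] (m : Y ⟶ Spec (CommRingCat.of K)) :
    IsPushout ((Scheme.ΓSpecIso (CommRingCat.of K)).inv ≫ m.appTop) (CommRingCat.ofHom α)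
      (pullback.fst m (specHom α)).appTop
      ((Scheme.ΓSpecIso (CommRingCat.of F)).inv ≫ (pullback.snd m (specHom α)).appTop) := by
  have := flat_specHom α
  have H := IsPullback.of_hasPullback m (specHom α)
  have h := (isIso_pushoutSection_iff H (US := ⊤) (UT := ⊤) (UX := ⊤) (UY := ⊤) le_rfl le_rfl
    (by simp)).1 (isIso_pushoutSection_of_isQuasiSeparated_of_flat_right H _ _ _
      (isAffineOpen_top _) (isAffineOpen_top _) isCompact_univ isQuasiSeparated_univ)
  have key : ∀ {A B : Scheme.{u}} (f : A ⟶ B) (h : (⊤ : A.Opens) ≤ f ⁻¹ᵁ ⊤),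
      f.appLE ⊤ ⊤ h = f.appTop := fun f _ => f.appLE_eq_app
  simp only [key] at h
  refine h.of_iso (Scheme.ΓSpecIso (CommRingCat.of K)) (Iso.refl _)
    (Scheme.ΓSpecIso (CommRingCat.of F)) (Iso.refl _) ?_ ?_ ?_ ?_
  · simp [key m le_rfl]
  · rw [key (specHom α) le_rfl]
    exact Scheme.ΓSpecIso_naturality (CommRingCat.ofHom α)
  · simp
  · simp

/-- If the field `K` is algebraically closed in the global functions of `Y` then `Y` stays connected
under algebraic extensions of `K`. -/
lemma connectedSpace_pullback_specHom {K F : Type u} [Field K] [CharZero K] [Field F] (α : K →+* F)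
    (hα : α.IsIntegral) {Y : Scheme.{u}} [CompactSpace Y] [QuasiSeparatedSpace Y] [Nonempty Y]
    (m : Y ⟶ Spec (CommRingCat.of K))
    (hm : ∀ b : Γ(Y, ⊤), (((Scheme.ΓSpecIso (CommRingCat.of K)).inv ≫ m.appTop).hom).IsIntegralElem b →
      ∃ c : K, ((Scheme.ΓSpecIso (CommRingCat.of K)).inv ≫ m.appTop).hom c = b) :
    ConnectedSpace (pullback m (specHom α) : Scheme.{u}) := by
  have := surjective_specHom α
  have : Nonempty (pullback m (specHom α) : Scheme.{u}) := by
    obtain ⟨x, -⟩ := (pullback.fst m (specHom α)).surjective (Classical.arbitrary Y)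
    exact ⟨x⟩
  refine connectedSpace_of_isIdempotentElem _ fun e he => ?_
  let ρ : K →+* Γ(Y, ⊤) := ((Scheme.ΓSpecIso (CommRingCat.of K)).inv ≫ m.appTop).hom
  let _ : Algebra K Γ(Y, ⊤) := ρ.toAlgebra
  let _ : Algebra K F := α.toAlgebra
  have : Algebra.IsIntegral K F := ⟨hα⟩
  have : Algebra.IsAlgebraic K F := inferInstance
  -- Two pushouts of the same span: the global functions on the base change are F ⊗ Γ(Y), where
  -- idempotents are under control.
  have h := (isPushout_globalSections_pullback α m).flip
  have h' := CommRingCat.isPushout_tensorProduct K F Γ(Y, ⊤)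
  let f : Γ(pullback m (specHom α), ⊤) ≃+* F ⊗[K] Γ(Y, ⊤) :=
    (h.isColimit.coconePointUniqueUpToIso h'.isColimit).commRingCatIsoToRingEquiv
  have hfe : IsIdempotentElem (f e) := by
    unfold IsIdempotentElem
    rw [← map_mul, he.eq]
  rcases eq_zero_or_one_of_isIdempotentElem_tensor (K := K) hm (f e) hfe with h0 | h1
  · exact Or.inl ((map_eq_zero_iff f f.injective).1 h0)
  · exact Or.inr ((map_eq_one_iff f f.injective).1 h1)

end GeometricConnectedness

/-! ### Connectedness of the X_{μ,α} -/

section Geom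

variable {k : Type u} [Field k] {X : Scheme.{u}} {s : X ⟶ Spec (CommRingCat.of k)}
  {M : CoverFamily.{u, w} s}

lemma toConst_appTop {Y : Scheme.{u}} (t : Y ⟶ Spec (CommRingCat.of k)) :
    (Scheme.ΓSpecIso (CommRingCat.of (ConstFn t))).inv ≫ (toConst t).appTop =
      CommRingCat.ofHom (R := ConstFn t) (S := Γ(Y, ⊤))
        ((ConstFn t).val : ConstFn t →+* GlobalFn t) := by
  rw [toConst, Scheme.Hom.comp_appTop, ← Category.assoc, ← Scheme.ΓSpecIso_inv_naturality,
    Category.assoc, Scheme.toSpecΓ_appTop, Iso.inv_hom_id, Category.comp_id]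

namespace CoverFamily

instance (μ : M.Name) : ConnectedSpace (M.cover μ).obj.left := (M.galois μ).1

instance [Smooth s] (μ : M.Name) : Smooth (M.str μ) :=
  inferInstanceAs (Smooth ((M.cover μ).obj.hom ≫ s))

instance [LocallyOfFiniteType s] (μ : M.Name) : LocallyOfFiniteType (M.str μ) :=
  inferInstanceAs (LocallyOfFiniteType ((M.cover μ).obj.hom ≫ s))

instance [IsSeparated s] (μ : M.Name) : IsSeparated (M.str μ) :=
  inferInstanceAs (IsSeparated ((M.cover μ).obj.hom ≫ s))

instance [QuasiCompact s] (μ : M.Name) : QuasiCompact (M.str μ) :=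
  inferInstanceAs (QuasiCompact ((M.cover μ).obj.hom ≫ s))

/-- The schemes `X_{μ,α}` are connected. -/
instance connectedSpace_geom [CharZero k] [Smooth s] [IsSeparated s] [QuasiCompact s]
    (i : M.Index) : ConnectedSpace (geom i) := by
  let t := M.str i.name
  have : CompactSpace (M.cover i.name).obj.left := QuasiCompact.compactSpace_of_compactSpace t
  have : QuasiSeparatedSpace (M.cover i.name).obj.left :=
    quasiSeparatedSpace_of_quasiSeparated t
  have hK := isField_constFn t
  have hc : CharZero (ConstFn t) :=
    have := hK.nontrivial
    charZero_of_injective_algebraMap (algebraMap k (ConstFn t)).injective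
  let _ := hK.toField
  refine connectedSpace_pullback_specHom (K := ConstFn t) (i.emb : ConstFn t →+* AlgebraicClosure k)
    ?_ (toConst t) ?_
  · intro a
    have h := Algebra.IsIntegral.isIntegral (R := k) a
    have h' : RingHom.IsIntegralElem ((i.emb : ConstFn t →+* AlgebraicClosure k).comp
        (algebraMap k (ConstFn t))) a := by
      rw [AlgHom.comp_algebraMap]
      exact h
    exact RingHom.IsIntegralElem.of_comp h'
  · intro b hb
    have h : (Scheme.ΓSpecIso (CommRingCat.of (ConstFn t))).inv ≫ (toConst t).appTop =
        CommRingCat.ofHom (R := ConstFn t) (S := Γ((M.cover i.name).obj.left, ⊤))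
          ((ConstFn t).val : ConstFn t →+* GlobalFn t) := toConst_appTop t
    rw [h] at hb ⊢
    -- By transitivity of integrality, a function integral over k^μ is integral over k, hence
    -- already in k^μ.
    have hb' : IsIntegral (ConstFn t) (A := GlobalFn t) b := hb
    have hb'' : IsIntegral k (A := GlobalFn t) b :=
      isIntegral_trans (A := ConstFn t) (B := GlobalFn t) b hb'
    exact ⟨⟨b, hb''⟩, rfl⟩

end CoverFamily

end Geom

/-! ### Points of the X_{μ,α} and the action of Galois on them -/

section GeomPoints

variable {k : Type u} [Field k] {X : Scheme.{u}} {s : X ⟶ Spec (CommRingCat.of k)}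

lemma connectedSpace_base [GeometricallyConnected s] : ConnectedSpace X :=
  have : Nonempty (Spec (CommRingCat.of k)) := ⟨IsLocalRing.closedPoint k⟩
  have : Subsingleton (Spec (CommRingCat.of k)) :=
    inferInstanceAs (Subsingleton (PrimeSpectrum k))
  GeometricallyConnected.connectedSpace_of_subsingleton s

lemma connectedSpace_constCover [CharZero k] [GeometricallyConnected s]
    (L : IntermediateField k (AlgebraicClosure k)) [FiniteDimensional k L] :
    ConnectedSpace (constCover s L).obj.left :=
  GeometricallyConnected.geometrically_connectedSpace _ _ _
    (IsPullback.of_hasPullback s (specHom (algebraMap k L)))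

/-- A nonempty scheme locally of finite type over `k` has a `k^alg`-point. -/
lemma nonempty_pt [LocallyOfFiniteType s] [Nonempty X] : Nonempty (Pt s) := by
  have : Surjective s := ⟨fun x => ⟨Classical.arbitrary X,
    Subsingleton.elim (α := PrimeSpectrum k) _ _⟩⟩
  obtain ⟨a, ha⟩ := exists_lift_of_surjective s (specHom (algebraMap k (AlgebraicClosure k)))
  exact ⟨⟨a, ha⟩⟩

variable {M : CoverFamily.{u, w} s}

namespace CoverFamily

/-- The point of `X_{μ,α}` given by a point of `X_μ` whose field of constants is embedded by `α`. -/
def GeomPt.ofPt (i : M.Index) (y : Pt (M.str i.name)) (h : y.emb = i.emb) : GeomPt i where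
  hom := geomLift i y.hom (𝟙 _) (by rw [← Pt.specHom_emb, h, Category.id_comp])
  w := geomLift_str _ _ _ _

lemma GeomPt.toPt_ofPt (i : M.Index) (y : Pt (M.str i.name)) (h : y.emb = i.emb) :
    (GeomPt.ofPt i y h).toPt = y :=
  Pt.ext (geomLift_proj _ _ _ _)

lemma GeomPt.toPt_hom {i : M.Index} (t : GeomPt i) : t.toPt.hom = t.hom ≫ geomProj i := rfl

lemma GeomPt.toPt_injective {i : M.Index} {t t' : GeomPt i} (h : t.toPt = t'.toPt) : t = t' :=
  GeomPt.ext (geom_hom_ext (congrArg Pt.hom h) (t.w.trans t'.w.symm))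

lemma GeomPt.emb_toPt {i : M.Index} (t : GeomPt i) : t.toPt.emb = i.emb := by
  refine algHom_eq_of_specHom_eq ?_
  rw [Pt.specHom_emb, GeomPt.toPt_hom, Category.assoc, geom_condition, ← Category.assoc, t.w,
    Category.id_comp]

lemma GeomHom.app_hom {i j : M.Index} (f : GeomHom i j) (t : GeomPt i) :
    (f.app t).hom = t.hom ≫ f.hom := rfl

lemma GeomHom.comp_app {i j l : M.Index} (g : GeomHom j l) (f : GeomHom i j) (t : GeomPt i) :
    (g.comp f).app t = g.app (f.app t) :=
  GeomPt.ext (Category.assoc _ _ _).symm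

/-- Conjugation is compatible with the action on points. -/
lemma GeomHom.toPt_conj_app {i j : M.Index} (σ : GalK k) (f : GeomHom i j) (t : GeomPt i)
    (t' : GeomPt (σ • i)) (h : t'.toPt = (σ • t.toPt : Pt (M.str i.name))) :
    ((f.conj σ).app t').toPt = (σ • (f.app t).toPt : Pt (M.str j.name)) := by
  have ht : t'.hom ≫ twist σ i = specHom (σ : AlgebraicClosure k →+* AlgebraicClosure k) ≫ t.hom := by
    refine geom_hom_ext ?_ ?_
    · rw [Category.assoc, twist_proj, Category.assoc]
      exact congrArg Pt.hom h
    · rw [Category.assoc, twist_str, ← Category.assoc, t'.w, Category.assoc, t.w, Category.comp_id,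
        Category.id_comp]
  refine Pt.ext ?_
  rw [Pt.smul_hom, GeomPt.toPt_hom, GeomPt.toPt_hom, GeomHom.app_hom, GeomHom.app_hom,
    Category.assoc]
  refine (congrArg (t'.hom ≫ ·) (f.conj_proj σ)).trans ?_
  change t'.hom ≫ twist σ i ≫ f.hom ≫ geomProj j = _
  rw [← Category.assoc, ht, Category.assoc, Category.assoc]

/-- A k^alg-point of X_μ is defined over a finite extension E of k. The embedding of the constants
that it induces is fixed by the automorphisms over E, so it takes values in E, and it is injective
because k^μ is a field. -/
lemma finiteDimensional_constFn [CharZero k] [Smooth s] [GeometricallyConnected s] (μ : M.Name) :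
    FiniteDimensional k (ConstFn (M.str μ)) := by
  have : Nonempty (Pt (M.str μ)) := nonempty_pt
  let y : Pt (M.str μ) := Classical.arbitrary _
  obtain ⟨E, hE, h⟩ := exists_finite_smul_eq _ y
  have hy : ∀ a, y.emb a ∈ E := by
    intro a
    rw [← InfiniteGalois.fixedField_fixingSubgroup E, IntermediateField.mem_fixedField_iff]
    intro σ hσ
    exact congr($((Pt.emb_smul σ y).symm.trans (congrArg Pt.emb (h σ hσ))) a)
  let _ := (isField_constFn (M.str μ)).toField
  let e : ConstFn (M.str μ) →ₗ[k] E :=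
    LinearMap.codRestrict E.toSubmodule y.emb.toLinearMap hy
  have he : Function.Injective e := fun a b hab =>
    (RingHom.injective (y.emb : ConstFn (M.str μ) →+* AlgebraicClosure k))
      (congrArg Subtype.val hab)
  exact Module.Finite.of_injective e he

/-- Every embedding of the constants is realised in the fibre over a given point. -/
lemma exists_geomPt [CharZero k] [Smooth s] [GeometricallyConnected s] (x : Pt s) (i : M.Index) :
    ∃ t : GeomPt i, t.hom ≫ geomMap i = x.hom := by
  have hK := isField_constFn (M.str i.name)
  have hinj : Function.Injective i.emb := by
    let _ := hK.toField
    exact RingHom.injective (i.emb : ConstFn (M.str i.name) →+* AlgebraicClosure k)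
  have := finiteDimensional_constFn (M := M) i.name
  let e : ConstFn (M.str i.name) ≃ₐ[k] i.emb.range := AlgEquiv.ofInjective i.emb hinj
  let L : IntermediateField k (AlgebraicClosure k) :=
    i.emb.range.toIntermediateField' (e.symm.toMulEquiv.isField hK)
  let e' : ConstFn (M.str i.name) ≃ₐ[k] L := e
  let ψ : L →ₐ[k] ConstFn (M.str i.name) := e'.symm
  have : FiniteDimensional k L := LinearEquiv.finiteDimensional e'.toLinearEquiv
  -- With L the image of α, the constants give a morphism from X_μ to X ×_k L. The target is
  -- connected by geometric connectedness of X, so the point given by x and the inclusion of L lifts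
  -- to X_μ, and a lift induces the embedding α.
  have := connectedSpace_constCover (s := s) L
  let m : M.cover i.name ⟶ constCover s L := FEt.homMk
    (constLift s (M.cover i.name).obj.hom
      (toConst (M.str i.name) ≫ specHom (ψ : L →+* ConstFn (M.str i.name))) (by
      rw [Category.assoc, ← Spec.map_comp, ← CommRingCat.ofHom_comp, AlgHom.comp_algebraMap,
        toConst_comp]
      rfl)) (constLift_hom _ _ _ _)
  obtain ⟨y, hy⟩ := FEt.map_surjective m (constPt x L L.val)
  let y' : Pt (M.str i.name) := ⟨y.hom, by
    rw [CoverFamily.str, ← Category.assoc, y.w, x.w]⟩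
  have hemb : y'.emb.comp ψ = L.val := by
    refine algHom_eq_of_specHom_eq ?_
    have h1 : y.hom ≫ m.hom.left ≫ constProj s L = specHom (L.val : L →+* AlgebraicClosure k) := by
      rw [← Category.assoc, ← fibreFunctor_map_hom, hy]
      exact constLift_proj _ _ _ _
    rw [← h1]
    have h2 : m.hom.left ≫ constProj s L =
      toConst (M.str i.name) ≫ specHom (ψ : L →+* ConstFn (M.str i.name)) :=
      constLift_proj _ _ _ _
    rw [h2, ← Category.assoc]
    have h3 : y.hom ≫ toConst (M.str i.name) =
      specHom (y'.emb : ConstFn (M.str i.name) →+* AlgebraicClosure k) := (Pt.specHom_emb y').symm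
    rw [h3, ← Spec.map_comp]
    rfl
  have hemb' : y'.emb = i.emb := by
    ext a
    have := congr($hemb (e' a))
    have h4 : ψ (e' a) = a := e'.symm_apply_apply a
    rw [← h4]
    exact this.trans (congrArg i.emb h4.symm)
  refine ⟨GeomPt.ofPt i y' hemb', ?_⟩
  rw [geomMap, ← Category.assoc]
  exact (congrArg (· ≫ (M.cover i.name).obj.hom)
    (congrArg Pt.hom (GeomPt.toPt_ofPt i y' hemb'))).trans y.w

section

variable [CharZero k] [Smooth s] [IsSeparated s] [QuasiCompact s]

/-- Morphisms over `X` from `X_{μ,α}` to a finite étale cover are determined by the image of one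
point. -/
lemma geom_hom_eq_of_comp_eq {i : M.Index} {Y : FEt X} {f g : geom i ⟶ Y.obj.left}
    (hf : f ≫ Y.obj.hom = geomMap i) (hg : g ≫ Y.obj.hom = geomMap i) (t : GeomPt i)
    (h : t.hom ≫ f = t.hom ≫ g) : f = g :=
  hom_eq_of_comp_eq Y.obj.hom f g (hf.trans hg.symm) t.hom h

/-- Intermediate morphisms are determined by the image of one point. -/
lemma GeomHom.eq_of_app_eq {i j : M.Index} {f g : GeomHom i j} (t : GeomPt i)
    (h : f.app t = g.app t) : f = g := by
  refine GeomHom.ext (geom_hom_ext ?_ (f.w_str.trans g.w_str.symm))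
  refine geom_hom_eq_of_comp_eq (Y := M.cover j.name) ?_ ?_ t ?_
  · rw [Category.assoc]; exact f.w_map
  · rw [Category.assoc]; exact g.w_map
  · rw [← Category.assoc, ← Category.assoc]
    exact congrArg (· ≫ geomProj j) (congrArg GeomPt.hom h)

end

end CoverFamily

end GeomPoints

/-! ### Closedness of G^♯ and the action of Galois on both structures -/

section DistinguishedGalois

open CoverFamily

variable {k : Type u} [Field k] {X : Scheme.{u}} {s : X ⟶ Spec (CommRingCat.of k)}
  {M : CoverFamily.{u, w} s}

/-- An automorphism that fixes a point of `X_{μ,α}` fixes `α`. -/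
lemma CoverFamily.GeomPt.comp_emb_eq_of_smul_toPt_eq {i : M.Index} (t : GeomPt i) {σ : GalK k}
    (h : σ • t.toPt = t.toPt) :
    (σ : AlgebraicClosure k →ₐ[k] AlgebraicClosure k).comp i.emb = i.emb := by
  rw [← t.emb_toPt, ← Pt.emb_smul, h]

lemma CoverFamily.emb_smul_toPt {i : M.Index} (σ : GalK k) (t : GeomPt i) :
    (σ • t.toPt).emb = (σ • i).emb := by
  rw [Pt.emb_smul, t.emb_toPt]
  rfl

namespace DistinguishedSystem

variable (D : DistinguishedSystem M)

/-- The group `G^♯` is closed. -/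
lemma isClosed_gSharp [CharZero k] [Smooth s] [IsSeparated s] [QuasiCompact s]
    [GeometricallyConnected s] : IsClosed (D.GSharp : Set (GalK k)) := by
  have hS : (D.GSharp : Set (GalK k)) = ⋂ (i : M.Index) (j : M.Index) (h : Nonempty (GeomHom i j)),
      {σ | (D.hom i j h).conj σ = D.hom (σ • i) (σ • j) (GeomHom.nonempty_conj σ h)} := by
    ext σ
    simp only [Set.mem_iInter]
    rfl
  rw [hS]
  refine isClosed_iInter fun i => isClosed_iInter fun j => isClosed_iInter fun h => ?_
  obtain ⟨x⟩ : Nonempty (Pt s) :=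
    have := connectedSpace_base (s := s)
    nonempty_pt
  obtain ⟨t, -⟩ := exists_geomPt x i
  let z := (D.hom i j h).app t
  -- The condition on σ is restated as a predicate of the two embeddings and the two points as free
  -- variables, so that it can be rewritten when another automorphism has the same effect on these
  -- data.
  let W : (ConstFn (M.str i.name) →ₐ[k] AlgebraicClosure k) →
      (ConstFn (M.str j.name) →ₐ[k] AlgebraicClosure k) → Pt (M.str i.name) → Pt (M.str j.name) →
      Prop := fun α β y y' => ∀ (h' : Nonempty (GeomHom (⟨i.name, α⟩ : M.Index) ⟨j.name, β⟩))
    (t' : GeomPt (⟨i.name, α⟩ : M.Index)), t'.toPt = y →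
      ((D.hom ⟨i.name, α⟩ ⟨j.name, β⟩ h').app t').toPt = y'
  have hW : ∀ σ : GalK k, (D.hom i j h).conj σ =
        D.hom (σ • i) (σ • j) (GeomHom.nonempty_conj σ h) ↔
      W ((σ : AlgebraicClosure k →ₐ[k] AlgebraicClosure k).comp i.emb)
        ((σ : AlgebraicClosure k →ₐ[k] AlgebraicClosure k).comp j.emb)
        (σ • t.toPt) (σ • z.toPt) := by
    intro σ
    constructor
    · intro hσ h' t' ht'
      have := GeomHom.toPt_conj_app σ (D.hom i j h) t t' ht'
      rw [hσ] at this
      exact this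
    · intro hσ
      let t' : GeomPt (σ • i) := GeomPt.ofPt (σ • i) (σ • t.toPt) (emb_smul_toPt σ t)
      have ht' : t'.toPt = (σ • t.toPt : Pt (M.str i.name)) := GeomPt.toPt_ofPt (σ • i) _ _
      refine GeomHom.eq_of_app_eq t' (GeomPt.toPt_injective ?_)
      exact (GeomHom.toPt_conj_app σ (D.hom i j h) t t' ht').trans
        (hσ (GeomHom.nonempty_conj σ h) t' ht').symm
  -- The complement contains with σ the coset σU, where U fixes t and its image z. A point
  -- determines the embedding of the constants, so U fixes α and β too.
  refine ⟨isOpen_iff_mem_nhds.2 fun σ hσ => ?_⟩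
  let U : Subgroup (GalK k) := MulAction.stabilizer (GalK k) t.toPt ⊓
    MulAction.stabilizer (GalK k) z.toPt
  have hU : IsOpen (U : Set (GalK k)) := (isOpen_stabilizer _ t.toPt).inter
    (isOpen_stabilizer _ z.toPt)
  refine Filter.mem_of_superset ((hU.preimage (continuous_const_mul σ⁻¹)).mem_nhds
    (by simp [U.one_mem])) fun τ hτ => ?_
  obtain ⟨υ, rfl⟩ : ∃ υ, τ = σ * υ := ⟨σ⁻¹ * τ, by simp⟩
  have hυ : υ ∈ U := by simpa using hτ
  have h1 : υ • t.toPt = t.toPt := hυ.1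
  have h2 : υ • z.toPt = z.toPt := hυ.2
  have e1 : ((σ * υ : GalK k) : AlgebraicClosure k →ₐ[k] AlgebraicClosure k).comp i.emb =
      (σ : AlgebraicClosure k →ₐ[k] AlgebraicClosure k).comp i.emb := by
    conv_rhs => rw [← t.comp_emb_eq_of_smul_toPt_eq h1]
    rfl
  have e2 : ((σ * υ : GalK k) : AlgebraicClosure k →ₐ[k] AlgebraicClosure k).comp j.emb =
      (σ : AlgebraicClosure k →ₐ[k] AlgebraicClosure k).comp j.emb := by
    conv_rhs => rw [← z.comp_emb_eq_of_smul_toPt_eq h2]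
    rfl
  intro hc
  have hc' := (hW (σ * υ)).1 hc
  rw [mul_smul, mul_smul, h1, h2, e1, e2] at hc'
  exact hσ ((hW σ).2 hc')

/-- If `k^♯ = k` then all elements of `Gal_k` preserve the distinguished morphisms. -/
lemma gSharp_eq_top [CharZero k] [Smooth s] [IsSeparated s] [QuasiCompact s]
    [GeometricallyConnected s] (hk : D.kSharp = ⊥) : D.GSharp = ⊤ := by
  have h := InfiniteGalois.fixingSubgroup_fixedField
    (⟨D.GSharp, D.isClosed_gSharp⟩ : ClosedSubgroup (GalK k))
  have h' : IntermediateField.fixedField D.GSharp = ⊥ := hk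
  change (IntermediateField.fixedField D.GSharp).fixingSubgroup = D.GSharp at h
  rw [← h, h', IntermediateField.fixingSubgroup_bot]

section Action

variable {D}

/-- Used for indices such as `σ⁻¹ • σ • i` and `i`, which are only propositionally equal but have
definitionally the same name. As points of X_μ the two components then have the same type, and the
heterogeneous equality becomes an ordinary one. -/
lemma UnivCov.toPt_pt_eq {i j : M.Index} (hn : i = j) (u : D.UnivCov) :
    HEq (u.pt i).toPt (u.pt j).toPt := by
  subst hn
  rfl

lemma UnivCov.ext_toPt {u v : D.UnivCov} (h : ∀ i, (u.pt i).toPt = (v.pt i).toPt) : u = v :=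
  UnivCov.ext (funext fun i => GeomPt.toPt_injective (h i))

lemma UnivCov.emb_smul_pt_inv (σ : GalK k) (u : D.UnivCov) (i : M.Index) :
    (σ • (u.pt (σ⁻¹ • i)).toPt : Pt (M.str i.name)).emb = i.emb := by
  refine (emb_smul_toPt σ (u.pt (σ⁻¹ • i))).trans (AlgHom.ext fun a => ?_)
  exact AlgEquiv.apply_symm_apply σ (i.emb a)

/-- The action of an automorphism that preserves the distinguished morphisms on the universal étale
cover. -/
def UnivCov.gal (hD : D.GSharp = ⊤) (σ : GalK k) (u : D.UnivCov) : D.UnivCov where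
  pt i := GeomPt.ofPt i (σ • (u.pt (σ⁻¹ • i)).toPt) (u.emb_smul_pt_inv σ i)
  compat i j h := by
    have hσ : σ ∈ D.GSharp := hD ▸ Subgroup.mem_top σ
    obtain ⟨a, rfl⟩ : ∃ a, i = σ • a := ⟨σ⁻¹ • i, (smul_inv_smul σ i).symm⟩
    obtain ⟨b, rfl⟩ : ∃ b, j = σ • b := ⟨σ⁻¹ • j, (smul_inv_smul σ j).symm⟩
    refine GeomPt.toPt_injective ?_
    have h₀ := GeomHom.nonempty_of_conj σ h
    -- The distinguished morphism between the σ-translates is the conjugate of the one from a to b.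
    rw [← hσ a b h₀]
    have ha : (u.pt (σ⁻¹ • σ • a)).toPt = ((u.pt a).toPt : Pt (M.str a.name)) :=
      eq_of_heq (u.toPt_pt_eq (inv_smul_smul σ a))
    have hb : (u.pt (σ⁻¹ • σ • b)).toPt = ((u.pt b).toPt : Pt (M.str b.name)) :=
      eq_of_heq (u.toPt_pt_eq (inv_smul_smul σ b))
    refine (GeomHom.toPt_conj_app σ (D.hom a b h₀) (u.pt a) _
      ((GeomPt.toPt_ofPt (σ • a) _ _).trans (congrArg (σ • ·) ha))).trans ?_
    rw [u.compat]
    exact ((GeomPt.toPt_ofPt (σ • b) _ _).trans (congrArg (σ • ·) hb)).symm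

lemma UnivCov.toPt_gal (hD : D.GSharp = ⊤) (σ : GalK k) (u : D.UnivCov) (i : M.Index) :
    ((u.gal hD σ).pt (σ • i)).toPt = (σ • (u.pt i).toPt : Pt (M.str i.name)) :=
  (GeomPt.toPt_ofPt (σ • i) _ (u.emb_smul_pt_inv σ (σ • i))).trans
    (congrArg (fun y : Pt (M.str i.name) => σ • y)
    (eq_of_heq (u.toPt_pt_eq (inv_smul_smul σ i))))

/-- Every index has the form `σ • i`, so these equations determine all components of v. This gives
the action laws, and it shows that an automorphism of the first structure is determined by its field
part. -/
lemma UnivCov.eq_gal_of_toPt_eq (hD : D.GSharp = ⊤) (σ : GalK k) (u v : D.UnivCov)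
    (h : ∀ i, (v.pt (σ • i)).toPt = (σ • (u.pt i).toPt : Pt (M.str i.name))) :
    v = u.gal hD σ := by
  refine UnivCov.ext_toPt fun i => ?_
  obtain ⟨a, rfl⟩ : ∃ a, i = σ • a := ⟨σ⁻¹ • i, (smul_inv_smul σ i).symm⟩
  exact (h a).trans (u.toPt_gal hD σ a).symm

/-- The action of `Gal_k` on the universal étale cover. -/
abbrev UnivCov.mulAction (hD : D.GSharp = ⊤) : MulAction (GalK k) D.UnivCov where
  smul σ u := u.gal hD σ
  one_smul u := (u.eq_gal_of_toPt_eq hD 1 u fun i => (one_smul _ (u.pt i).toPt).symm).symm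
  mul_smul σ τ u := by
    refine (UnivCov.eq_gal_of_toPt_eq hD (σ * τ) u _ fun i => ?_).symm
    refine ((u.gal hD τ).toPt_gal hD σ (τ • i)).trans ?_
    refine (congrArg (fun y : Pt (M.str i.name) => σ • y) (u.toPt_gal hD τ i)).trans ?_
    exact (mul_smul σ τ (u.pt i).toPt).symm

/-- The permutations of the universal étale cover given by `Gal_k`. -/
def UnivCov.perm (hD : D.GSharp = ⊤) : GalK k →* Equiv.Perm D.UnivCov :=
  let _ := UnivCov.mulAction hD
  MulAction.toPermHom (GalK k) D.UnivCov

lemma UnivCov.perm_inv_apply (hD : D.GSharp = ⊤) (σ : GalK k) (u : D.UnivCov) :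
    UnivCov.perm hD σ⁻¹ (UnivCov.perm hD σ u) = u := by
  rw [← Equiv.Perm.mul_apply, ← map_mul, inv_mul_cancel, map_one, Equiv.Perm.one_apply]

lemma AutSharp.perm_mem (hD : D.GSharp = ⊤) (σ : GalK k) :
    (UnivCov.perm hD σ, σ) ∈ D.AutSharp :=
  fun i u => u.toPt_gal hD σ i

lemma AutSharp.fst_eq (hD : D.GSharp = ⊤) (τ : D.AutSharp) :
    τ.1.1 = UnivCov.perm hD τ.1.2 :=
  Equiv.ext fun u => UnivCov.eq_gal_of_toPt_eq hD _ _ _ fun i => τ.2 i u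

lemma AutSharp.bijective_toGal (hD : D.GSharp = ⊤) :
    Function.Bijective (AutSharp.toGal : D.AutSharp →* GalK k) := by
  refine ⟨fun τ τ' h => ?_, fun σ => ⟨⟨_, AutSharp.perm_mem hD σ⟩, rfl⟩⟩
  have h' : τ.1.2 = τ'.1.2 := h
  exact Subtype.ext (Prod.ext (by rw [AutSharp.fst_eq hD, AutSharp.fst_eq hD, h']) h')

/-- The conjugate by `σ` of a map from the universal étale cover. -/
def conjMap (hD : D.GSharp = ⊤) (σ : GalK k) {μ : M.Name} (q : D.UnivCov → Pt (M.str μ)) :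
    D.UnivCov → Pt (M.str μ) :=
  fun u => σ • q (UnivCov.perm hD σ⁻¹ u)

lemma conjMap_perm (hD : D.GSharp = ⊤) (σ : GalK k) {μ : M.Name} (q : D.UnivCov → Pt (M.str μ))
    (u : D.UnivCov) : conjMap hD σ q (UnivCov.perm hD σ u) = σ • q u := by
  rw [conjMap, UnivCov.perm_inv_apply]

lemma conjMap_one (hD : D.GSharp = ⊤) {μ : M.Name} (q : D.UnivCov → Pt (M.str μ)) :
    conjMap hD 1 q = q := by
  funext u
  rw [conjMap, inv_one, map_one, one_smul, Equiv.Perm.one_apply]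

lemma conjMap_mul (hD : D.GSharp = ⊤) (σ τ : GalK k) {μ : M.Name}
    (q : D.UnivCov → Pt (M.str μ)) :
    conjMap hD (σ * τ) q = conjMap hD σ (conjMap hD τ q) := by
  funext u
  rw [conjMap, conjMap, conjMap, mul_inv_rev, map_mul, mul_smul, Equiv.Perm.mul_apply]

/-- The identity behind it is σ ∘ (g ∘ p_{μ,α}) ∘ σ⁻¹ = g^σ ∘ p_{μ,σ(α)}: applying σ to points turns
g into its conjugate and p_{μ,α}(v) into p_{μ,σ(α)}(σv). -/
lemma IsTranslate.conjMap (hD : D.GSharp = ⊤) (σ : GalK k) {i : M.Index} {g : GeomHom i i}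
    {q : D.UnivCov → Pt (M.str i.name)} (h : IsTranslate g q) :
    IsTranslate (g.conj σ) (conjMap hD σ q) := by
  intro u
  obtain ⟨v, rfl⟩ := (UnivCov.perm hD σ).surjective u
  refine (conjMap_perm hD σ q v).trans ((congrArg (σ • ·) (h v)).trans ?_)
  exact (GeomHom.toPt_conj_app σ g (v.pt i) _ (v.toPt_gal hD σ i)).symm

lemma InFibre.conjMap (hD : D.GSharp = ⊤) (σ : GalK k) {i : M.Index}
    {q : D.UnivCov → Pt (M.str i.name)} (h : InFibre i q) :
    InFibre (σ • i) (conjMap hD σ q) := by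
  obtain ⟨g, hg, hq⟩ := h
  exact ⟨g.conj σ, g.isIso_conj σ hg, hq.conjMap hD σ⟩

lemma InFibre.of_conjMap (hD : D.GSharp = ⊤) (σ : GalK k) {i : M.Index}
    {q : D.UnivCov → Pt (M.str i.name)}
    (h : InFibre (σ • i) (DistinguishedSystem.conjMap hD σ q)) : InFibre i q := by
  have h' := h.conjMap hD σ⁻¹
  have hq : DistinguishedSystem.conjMap hD σ⁻¹ (DistinguishedSystem.conjMap hD σ q) = q := by
    rw [← conjMap_mul, inv_mul_cancel, conjMap_one]
  -- Transport along `σ⁻¹ * σ = 1`, generalized to a variable τ because the type of the index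
  -- depends on it.
  have key : ∀ τ : GalK k, τ = 1 → InFibre (D := D) (τ • i) q → InFibre i q := by
    rintro τ rfl h
    exact h
  refine key _ (inv_mul_cancel σ) ?_
  rw [← hq]
  exact h'

lemma ActsTo.conjMap (hD : D.GSharp = ⊤) (σ : GalK k) {i : M.Index} {g : GeomHom i i}
    {q q' : D.UnivCov → Pt (M.str i.name)} (h : ActsTo g q q') :
    ActsTo (g.conj σ) (conjMap hD σ q) (DistinguishedSystem.conjMap hD σ q') := by
  obtain ⟨d, hd, hq, hq'⟩ := h
  refine ⟨d.conj σ, d.isIso_conj σ hd, hq.conjMap hD σ, ?_⟩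
  rw [← GeomHom.conj_comp]
  exact hq'.conjMap hD σ

lemma ActsTo.of_conjMap (hD : D.GSharp = ⊤) (σ : GalK k) {i : M.Index} {g : GeomHom i i}
    {q q' : D.UnivCov → Pt (M.str i.name)}
    (h : ActsTo (g.conj σ) (DistinguishedSystem.conjMap hD σ q)
      (DistinguishedSystem.conjMap hD σ q')) : ActsTo g q q' := by
  have h' := h.conjMap hD σ⁻¹
  have hq : ∀ q : D.UnivCov → Pt (M.str i.name),
      DistinguishedSystem.conjMap hD σ⁻¹ (DistinguishedSystem.conjMap hD σ q) = q := fun q => by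
    rw [← conjMap_mul, inv_mul_cancel, conjMap_one]
  have key : ∀ τ : GalK k, τ = 1 → ActsTo (D := D) (g.conj τ) q q' → ActsTo g q q' := by
    rintro τ rfl h
    rw [g.conj_one] at h
    exact h
  refine key _ (inv_mul_cancel σ) ?_
  rw [GeomHom.conj_mul]
  have h1 := hq q
  have h2 := hq q'
  rw [← h1, ← h2]
  exact h'

/-- The permutations of the sort of all maps `g ∘ p_{μ,α}` given by `Gal_k`. -/
def PTilde.perm (hD : D.GSharp = ⊤) (μ : M.Name) : GalK k →* Equiv.Perm (D.PTilde μ) :=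
  let _ : MulAction (GalK k) (D.PTilde μ) :=
    { smul := fun σ q => ⟨conjMap hD σ q.1, q.2.elim fun _ h => ⟨_, h.conjMap hD σ⟩⟩
      one_smul := fun q => Subtype.ext (conjMap_one hD q.1)
      mul_smul := fun σ τ q => Subtype.ext (conjMap_mul hD σ τ q.1) }
  MulAction.toPermHom (GalK k) (D.PTilde μ)

/-- The action of `Gal_k` on the sorts of the structure with the sorts of all maps
`g ∘ p_{μ,α}`. -/
def permOfGal (hD : D.GSharp = ⊤) :
    GalK k →* Equiv.Perm D.UnivCov × GalK k × ∀ μ, Equiv.Perm (D.PTilde μ) :=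
  (UnivCov.perm hD).prod ((MonoidHom.id _).prod (MonoidHom.pi (PTilde.perm hD)))

lemma permOfGal_mem (hD : D.GSharp = ⊤) (σ : GalK k) : permOfGal hD σ ∈ D.AutEt := by
  refine ⟨fun i q => ?_, fun i g _ q q' => ?_, fun μ q u => ?_⟩
  · change _ ↔ InFibre (σ • i) (conjMap hD σ q.1)
    exact ⟨fun h => h.conjMap hD σ, fun h => InFibre.of_conjMap hD σ h⟩
  · change _ ↔ ActsTo (g.conj σ) (conjMap hD σ q.1) (conjMap hD σ q'.1)
    exact ⟨fun h => h.conjMap hD σ, fun h => ActsTo.of_conjMap hD σ h⟩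
  · change conjMap hD σ q.1 (UnivCov.perm hD σ u) = _
    exact conjMap_perm hD σ q.1 u

/-- The action of `Gal_k` by automorphisms of the structure with the sorts of all maps
`g ∘ p_{μ,α}`. -/
def autEtOfGal (hD : D.GSharp = ⊤) : GalK k →* D.AutEt :=
  (permOfGal hD).codRestrict D.AutEt (permOfGal_mem hD)

lemma extends_autEtOfGal (hD : D.GSharp = ⊤) (τ : D.AutSharp) :
    Extends (autEtOfGal hD (AutSharp.toGal τ)) τ :=
  ⟨(AutSharp.fst_eq hD τ).symm, rfl⟩

/-- An automorphism of the full structure is determined by its action on the universal étale cover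
and on the field. -/
lemma Extends.unique {τ : D.AutSharp} {τ₁ τ₂ : D.AutEt} (h₁ : Extends τ₁ τ) (h₂ : Extends τ₂ τ) :
    τ₁ = τ₂ := by
  have e1 : τ₁.1.1 = τ₂.1.1 := h₁.1.trans h₂.1.symm
  have e2 : τ₁.1.2.1 = τ₂.1.2.1 := h₁.2.trans h₂.2.symm
  refine Subtype.ext (Prod.ext e1 (Prod.ext e2 (funext fun μ => Equiv.ext fun q =>
    Subtype.ext (funext fun u => ?_))))
  obtain ⟨v, rfl⟩ := τ₁.1.1.surjective u
  rw [τ₁.2.2.2 μ q v, e1, τ₂.2.2.2 μ q v, e2]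

end Action

end DistinguishedSystem

end DistinguishedGalois

/-! ### Directedness of the X_{μ,α} and points of the universal cover -/

section Directed

open CoverFamily

variable {k : Type u} [Field k] {X : Scheme.{u}} {s : X ⟶ Spec (CommRingCat.of k)}
  {M : CoverFamily.{u, w} s}

namespace CoverFamily

lemma twist_geomMap (σ : GalK k) (i : M.Index) : twist σ i ≫ geomMap i = geomMap (σ • i) := by
  rw [geomMap, ← Category.assoc, twist_proj]
  rfl

/-- The point of the fibre of `X_μ` given by a point of `X_{μ,α}`. -/
def GeomPt.toFib {i : M.Index} (t : GeomPt i) {x : Pt s} (h : t.hom ≫ geomMap i = x.hom) :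
    Fib x.hom (M.cover i.name) where
  hom := t.hom ≫ geomProj i
  w := (Category.assoc _ _ _).trans h

/-- Every point of a finite étale cover is the image of a point of some `X_{μ,α}`. -/
lemma exists_geomPt_map_eq [GeometricallyConnected s] (M : CoverFamily.{u, w} s) {x : Pt s}
    {Y : FEt X} (y : Fib x.hom Y) :
    ∃ (i : M.Index) (h : M.cover i.name ⟶ Y) (t : GeomPt i) (ht : t.hom ≫ geomMap i = x.hom),
      (fibreFunctor x.hom).map h (t.toFib ht) = y := by
  have := connectedSpace_base (s := s)
  obtain ⟨Z, hZ, f, z, hz⟩ := exists_isGaloisCover (s := s) Y y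
  obtain ⟨μ, ⟨m⟩⟩ := M.dominates Z hZ
  have := hZ.1
  obtain ⟨v, hv⟩ := FEt.map_surjective m z
  let v' : Pt (M.str μ) := ⟨v.hom, by rw [CoverFamily.str, ← Category.assoc, v.w, x.w]⟩
  let i : M.Index := ⟨μ, v'.emb⟩
  let t : GeomPt i := GeomPt.ofPt i v' rfl
  have htv : t.hom ≫ geomProj i = v.hom := congrArg Pt.hom (GeomPt.toPt_ofPt i v' rfl)
  have ht : t.hom ≫ geomMap i = x.hom := by
    rw [geomMap, ← Category.assoc, htv, v.w]
  refine ⟨i, m ≫ f, t, ht, ?_⟩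
  have : t.toFib ht = v := Fib.ext htv
  rw [this, fibreFunctor_map_comp, hv, hz]

/-- A morphism of covers that respects the embeddings of the constants at one point gives an
intermediate morphism. -/
lemma nonempty_geomHom {i l : M.Index} (a : M.cover l.name ⟶ M.cover i.name) (t : GeomPt l)
    (t' : GeomPt i) (h : t.toPt.hom ≫ a.hom.left = t'.toPt.hom) : Nonempty (GeomHom l i) := by
  obtain ⟨ψ, hψ⟩ := exists_toConst_factor (M.str l.name)
    (a.hom.left ≫ toConst (M.str i.name)) (by
      rw [Category.assoc, toConst_comp, CoverFamily.str, ← Category.assoc, FEt.w]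
      rfl)
  -- The morphism a induces ψ on constants, and the test points show that ψ matches the two
  -- embeddings in k^alg; only then does a lift to the base changes.
  have hemb : l.emb.comp ψ = i.emb := by
    rw [← t.emb_toPt, ← t'.emb_toPt]
    refine algHom_eq_of_specHom_eq ?_
    rw [Pt.specHom_emb, ← h, Category.assoc, ← hψ, ← Category.assoc, ← Pt.specHom_emb,
      ← Spec.map_comp]
    rfl
  have hc : (geomProj l ≫ a.hom.left) ≫ toConst (M.str i.name) =
      geomStr l ≫ specHom (i.emb : _ →+* AlgebraicClosure k) := by
    rw [Category.assoc, ← hψ, ← Category.assoc, geom_condition, Category.assoc, ← Spec.map_comp,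
      ← hemb]
    rfl
  refine ⟨⟨geomLift i (geomProj l ≫ a.hom.left) (geomStr l) hc, geomLift_str _ _ _ _, ?_⟩⟩
  rw [geomMap, ← Category.assoc, geomLift_proj, Category.assoc, FEt.w]
  rfl

/-- The schemes `X_{μ,α}` form a directed system. -/
lemma exists_geomHom_geomHom [CharZero k] [Smooth s] [GeometricallyConnected s] (i j : M.Index) :
    ∃ l : M.Index, Nonempty (GeomHom l i) ∧ Nonempty (GeomHom l j) := by
  obtain ⟨x⟩ : Nonempty (Pt s) :=
    have := connectedSpace_base (s := s)
    nonempty_pt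
  obtain ⟨t, ht⟩ := exists_geomPt x i
  obtain ⟨t', ht'⟩ := exists_geomPt x j
  -- A common dominating cover is chosen through a point over the pair of points t, t'. This also
  -- selects its embedding of the constants, so both projections give morphisms over k^alg.
  obtain ⟨p, hp, hp'⟩ := FEt.exists_prod_point (t.toFib ht) (t'.toFib ht')
  obtain ⟨l, h, v, hv, hvp⟩ := M.exists_geomPt_map_eq p
  refine ⟨l, nonempty_geomHom (h ≫ FEt.fst _ _) v t ?_, nonempty_geomHom (h ≫ FEt.snd _ _) v t' ?_⟩
  · have := fibreFunctor_map_comp h (FEt.fst _ _) (v.toFib hv)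
    rw [hvp, hp] at this
    exact congrArg Fib.hom this
  · have := fibreFunctor_map_comp h (FEt.snd _ _) (v.toFib hv)
    rw [hvp, hp'] at this
    exact congrArg Fib.hom this

end CoverFamily

namespace DistinguishedSystem

/-- The preorder on the indices given by intermediate morphisms. -/
abbrev indexPreorder (M : CoverFamily.{u, w} s) : Preorder M.Index where
  le i j := Nonempty (GeomHom j i)
  le_refl i := ⟨GeomHom.id i⟩
  le_trans _ _ _ h h' := h.elim fun f => h'.elim fun g => ⟨f.comp g⟩

/-- There are points of the universal étale cover over every point of `X`. -/
lemma exists_liesOver [CharZero k] [Smooth s] [GeometricallyConnected s]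
    (D : DistinguishedSystem M) (x : Pt s) : ∃ u : D.UnivCov, u.LiesOver x := by
  let _ := indexPreorder M
  have hdir : IsDirectedOrder M.Index := ⟨fun i j => exists_geomHom_geomHom i j⟩
  let F : M.Indexᵒᵖ ⥤ Type u :=
    { obj := fun i => {t : GeomPt i.unop // t.hom ≫ geomMap i.unop = x.hom}
      map := fun {i j} f => ↾fun t => ⟨(D.hom i.unop j.unop (leOfHom f.unop)).app t.1, by
        rw [GeomHom.app_hom, Category.assoc, GeomHom.w_map, t.2]⟩
      map_id := fun i => by
        refine congrArg (fun g => ↾g) (funext fun t => Subtype.ext ?_)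
        change (D.hom i.unop i.unop _).app t.1 = t.1
        rw [D.hom_id]
        exact GeomPt.ext (Category.comp_id _)
      map_comp := fun {i j l} f g => by
        refine congrArg (fun g => ↾g) (funext fun t => Subtype.ext ?_)
        change (D.hom i.unop l.unop _).app t.1 = (D.hom j.unop l.unop _).app
          ((D.hom i.unop j.unop _).app t.1)
        rw [← GeomHom.comp_app, D.hom_comp] }
  have hfin : ∀ i, Finite (F.obj i) := fun i =>
    Finite.of_injective (β := Fib x.hom (M.cover i.unop.name)) (fun t => t.1.toFib t.2)
      fun t t' h => Subtype.ext (GeomPt.toPt_injective (Pt.ext (congrArg Fib.hom h)))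
  have hne : ∀ i, Nonempty (F.obj i) := fun i => by
    obtain ⟨t, ht⟩ := exists_geomPt x i.unop
    exact ⟨⟨t, ht⟩⟩
  -- Compactness: a directed inverse system of nonempty finite sets has a nonempty limit.
  obtain ⟨v, hv⟩ := nonempty_sections_of_finite_inverse_system F
  refine ⟨⟨fun i => (v (Opposite.op i)).1, fun i j h => ?_⟩, fun i => (v (Opposite.op i)).2⟩
  have : j ≤ i := h
  exact congrArg Subtype.val (hv (homOfLE this).op)

end DistinguishedSystem

end Directed

/-! ### The section of the étale fundamental group attached to u -/

section GaloisSection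

open CoverFamily

variable {k : Type u} [Field k] {X : Scheme.{u}} {s : X ⟶ Spec (CommRingCat.of k)}
  {M : CoverFamily.{u, w} s}

namespace DistinguishedSystem

variable {D : DistinguishedSystem M} {x : Pt s}

/-- Every point of the fibre of a finite étale cover over `x` is the image of the component of `u`
in some `X_{μ,α}`. -/
lemma UnivCov.exists_map_eq [GeometricallyConnected s] {u : D.UnivCov} (hu : u.LiesOver x)
    {Y : FEt X} (y : Fib x.hom Y) :
    ∃ (i : M.Index) (h : M.cover i.name ⟶ Y), (u.pt i).hom ≫ geomProj i ≫ h.hom.left = y.hom := by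
  obtain ⟨i, h, t, ht, hy⟩ := M.exists_geomPt_map_eq y
  -- The component u_i need not be t, but an automorphism of X_μ over X moves it to t. This g may
  -- act nontrivially on the constants.
  obtain ⟨g, hg⟩ := (M.galois i.name).2 x ((u.pt i).toFib (hu i)) (t.toFib ht)
  refine ⟨i, g.hom ≫ h, ?_⟩
  rw [← hy, ← hg, ← fibreFunctor_map_comp]
  exact (Category.assoc _ _ _).symm

/-- `y'` is the image of `y` under the action of `σ` on the fibres of finite étale covers that
corresponds to `u`. -/
def UnivCov.Moves (u : D.UnivCov) (σ : GalK k) {Y : FEt X} (y y' : Fib x.hom Y) : Prop :=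
  ∃ (i : M.Index) (h : geom i ⟶ Y.obj.left), h ≫ Y.obj.hom = geomMap i ∧
    (u.pt i).hom ≫ h = y.hom ∧ (u.pt (σ • i)).hom ≫ twist σ i ≫ h = y'.hom

lemma UnivCov.exists_moves [GeometricallyConnected s] {u : D.UnivCov} (hu : u.LiesOver x)
    (σ : GalK k) {Y : FEt X} (y : Fib x.hom Y) : ∃ y', u.Moves σ y y' := by
  obtain ⟨i, h, hy⟩ := u.exists_map_eq hu y
  have hh : (geomProj i ≫ h.hom.left) ≫ Y.obj.hom = geomMap i := by
    rw [Category.assoc, FEt.w]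
    rfl
  refine ⟨⟨(u.pt (σ • i)).hom ≫ twist σ i ≫ geomProj i ≫ h.hom.left, ?_⟩, i, _, hh, hy, rfl⟩
  rw [Category.assoc, Category.assoc, hh, twist_geomMap, hu]

/-- Pull two witnesses h and h' back to a common X_l along distinguished morphisms. They agree at
u_l, hence everywhere by rigidity. Since conjugates of distinguished morphisms are distinguished,
u_{σ(i)} and u_{σ(j)} are the images of u_{σ(l)} under the conjugate morphisms, so both witnesses
yield the same translate. -/
lemma UnivCov.Moves.unique [CharZero k] [Smooth s] [IsSeparated s] [QuasiCompact s]
    [GeometricallyConnected s] {u : D.UnivCov}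
    (hD : D.GSharp = ⊤) {σ : GalK k} {Y : FEt X} {y y' y'' : Fib x.hom Y}
    (h₁ : u.Moves σ y y') (h₂ : u.Moves σ y y'') : y' = y'' := by
  obtain ⟨i, h, hh, hy, hy'⟩ := h₁
  obtain ⟨j, h', hh', hz, hy''⟩ := h₂
  obtain ⟨l, hli, hlj⟩ := exists_geomHom_geomHom i j
  have key : (D.hom l i hli).hom ≫ h = (D.hom l j hlj).hom ≫ h' := by
    refine geom_hom_eq_of_comp_eq ?_ ?_ (u.pt l) ?_
    · rw [Category.assoc, hh, GeomHom.w_map]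
    · rw [Category.assoc, hh', GeomHom.w_map]
    · have e1 := congrArg GeomPt.hom (u.compat l i hli)
      have e2 := congrArg GeomPt.hom (u.compat l j hlj)
      rw [GeomHom.app_hom] at e1 e2
      rw [← Category.assoc, ← Category.assoc, e1, e2, hy, hz]
  have hσ : σ ∈ D.GSharp := hD ▸ Subgroup.mem_top σ
  have e : ∀ (a : M.Index) (ha : Nonempty (GeomHom l a)), (u.pt (σ • a)).hom ≫ twist σ a =
      (u.pt (σ • l)).hom ≫ twist σ l ≫ (D.hom l a ha).hom := fun a ha => by
    rw [← u.compat (σ • l) (σ • a) (GeomHom.nonempty_conj σ ha), ← hσ l a ha, GeomHom.app_hom,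
      Category.assoc, GeomHom.conj_twist]
  refine Fib.ext ?_
  rw [← hy', ← hy'', ← Category.assoc, ← Category.assoc, e i hli, e j hlj]
  simp only [Category.assoc, key]

lemma UnivCov.Moves.map {u : D.UnivCov} {σ : GalK k} {Y Z : FEt X} {y y' : Fib x.hom Y}
    (h : u.Moves σ y y') (f : Y ⟶ Z) :
    u.Moves σ ((fibreFunctor x.hom).map f y) ((fibreFunctor x.hom).map f y') := by
  obtain ⟨i, h, hh, hy, hy'⟩ := h
  refine ⟨i, h ≫ f.hom.left, ?_, ?_, ?_⟩
  · rw [Category.assoc, FEt.w, hh]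
  · rw [fibreFunctor_map_hom, ← hy, Category.assoc]
  · rw [fibreFunctor_map_hom, ← hy']
    simp only [Category.assoc]

lemma UnivCov.moves_one [GeometricallyConnected s] {u : D.UnivCov} (hu : u.LiesOver x) {Y : FEt X}
    (y : Fib x.hom Y) : u.Moves 1 y y := by
  obtain ⟨i, h, hy⟩ := u.exists_map_eq hu y
  refine ⟨i, geomProj i ≫ h.hom.left, ?_, hy, ?_⟩
  · rw [Category.assoc, FEt.w]
    rfl
  · rw [twist_one]
    exact (congrArg _ (Category.id_comp _)).trans hy

/-- If h on X_i witnesses the first move, then `twist τ i` followed by h, on X_{τ(i)}, presents its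
end point y'; by uniqueness the second move may be computed from this presentation. -/
lemma UnivCov.Moves.trans [CharZero k] [Smooth s] [IsSeparated s] [QuasiCompact s]
    [GeometricallyConnected s] {u : D.UnivCov}
    (hu : u.LiesOver x) (hD : D.GSharp = ⊤) {σ τ : GalK k} {Y : FEt X} {y y' y'' : Fib x.hom Y}
    (h₁ : u.Moves τ y y') (h₂ : u.Moves σ y' y'') : u.Moves (σ * τ) y y'' := by
  obtain ⟨i, h, hh, hy, hy'⟩ := h₁
  have hh' : (twist τ i ≫ h) ≫ Y.obj.hom = geomMap (τ • i) := by
    rw [Category.assoc, hh, twist_geomMap]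
  let z : Fib x.hom Y := ⟨(u.pt (σ • τ • i)).hom ≫ twist σ (τ • i) ≫ twist τ i ≫ h, by
    rw [Category.assoc, Category.assoc, hh', twist_geomMap, hu]⟩
  have hz : u.Moves σ y' z := ⟨τ • i, twist τ i ≫ h, hh', hy', rfl⟩
  obtain rfl := h₂.unique hD hz
  refine ⟨i, h, hh, hy, ?_⟩
  rw [twist_mul]
  exact congrArg ((u.pt (σ • τ • i)).hom ≫ ·) (Category.assoc _ _ _)

/-- The action of `Gal_k` on the fibres of finite étale covers that corresponds to `u`. -/
def UnivCov.fibAct [GeometricallyConnected s] {u : D.UnivCov} (hu : u.LiesOver x) (σ : GalK k)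
    {Y : FEt X} (y : Fib x.hom Y) : Fib x.hom Y :=
  (u.exists_moves hu σ y).choose

lemma UnivCov.moves_fibAct [GeometricallyConnected s] {u : D.UnivCov} (hu : u.LiesOver x)
    (σ : GalK k) {Y : FEt X} (y : Fib x.hom Y) : u.Moves σ y (u.fibAct hu σ y) :=
  (u.exists_moves hu σ y).choose_spec

section

variable [CharZero k] [Smooth s] [IsSeparated s] [QuasiCompact s]
    [GeometricallyConnected s]

lemma UnivCov.fibAct_eq_iff {u : D.UnivCov} (hu : u.LiesOver x) (hD : D.GSharp = ⊤) {σ : GalK k}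
    {Y : FEt X} {y y' : Fib x.hom Y} : u.fibAct hu σ y = y' ↔ u.Moves σ y y' :=
  ⟨fun h => h ▸ (u.exists_moves hu σ y).choose_spec,
    fun h => (u.exists_moves hu σ y).choose_spec.unique hD h⟩

lemma UnivCov.fibAct_one {u : D.UnivCov} (hu : u.LiesOver x) (hD : D.GSharp = ⊤) {Y : FEt X}
    (y : Fib x.hom Y) : u.fibAct hu 1 y = y :=
  (u.fibAct_eq_iff hu hD).2 (u.moves_one hu y)

lemma UnivCov.fibAct_mul {u : D.UnivCov} (hu : u.LiesOver x) (hD : D.GSharp = ⊤) (σ τ : GalK k)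
    {Y : FEt X} (y : Fib x.hom Y) : u.fibAct hu (σ * τ) y = u.fibAct hu σ (u.fibAct hu τ y) :=
  (u.fibAct_eq_iff hu hD).2
    ((u.moves_fibAct hu τ y).trans hu hD (u.moves_fibAct hu σ (u.fibAct hu τ y)))

lemma UnivCov.fibAct_inv_fibAct {u : D.UnivCov} (hu : u.LiesOver x) (hD : D.GSharp = ⊤)
    (σ : GalK k) {Y : FEt X} (y : Fib x.hom Y) : u.fibAct hu σ⁻¹ (u.fibAct hu σ y) = y := by
  rw [← UnivCov.fibAct_mul hu hD, inv_mul_cancel, UnivCov.fibAct_one hu hD]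

lemma UnivCov.fibAct_fibAct_inv {u : D.UnivCov} (hu : u.LiesOver x) (hD : D.GSharp = ⊤)
    (σ : GalK k) {Y : FEt X} (y : Fib x.hom Y) : u.fibAct hu σ (u.fibAct hu σ⁻¹ y) = y := by
  rw [← UnivCov.fibAct_mul hu hD, mul_inv_cancel, UnivCov.fibAct_one hu hD]

lemma UnivCov.fibAct_map {u : D.UnivCov} (hu : u.LiesOver x) (hD : D.GSharp = ⊤) (σ : GalK k)
    {Y Z : FEt X} (f : Y ⟶ Z) (y : Fib x.hom Y) :
    u.fibAct hu σ ((fibreFunctor x.hom).map f y) =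
      (fibreFunctor x.hom).map f (u.fibAct hu σ y) :=
  (u.fibAct_eq_iff hu hD).2 ((u.moves_fibAct hu σ y).map f)

/-- The natural automorphism of the fibre functor given by an element of `Gal_k`. -/
def UnivCov.fibIso {u : D.UnivCov} (hu : u.LiesOver x) (hD : D.GSharp = ⊤) (σ : GalK k) :
    PiOne x.hom :=
  NatIso.ofComponents
    (fun Y =>
      { hom := FintypeCat.homMk fun y : Fib x.hom Y => u.fibAct hu σ y
        inv := FintypeCat.homMk fun y : Fib x.hom Y => u.fibAct hu σ⁻¹ y
        hom_inv_id := by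
          ext y : 1
          exact UnivCov.fibAct_inv_fibAct hu hD σ y
        inv_hom_id := by
          ext y : 1
          exact UnivCov.fibAct_fibAct_inv hu hD σ y })
    fun f => by
      ext y : 1
      exact UnivCov.fibAct_map hu hD σ f y

/-- The homomorphism from `Gal_k` to the étale fundamental group that corresponds to `u`. -/
def UnivCov.galToPiOne {u : D.UnivCov} (hu : u.LiesOver x) (hD : D.GSharp = ⊤) :
    GalK k →* PiOne x.hom where
  toFun σ := u.fibIso hu hD σ
  map_one' := by
    refine Iso.ext (NatTrans.ext (funext fun Y => ?_))
    ext y : 1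
    exact UnivCov.fibAct_one hu hD y
  map_mul' σ τ := by
    refine Iso.ext (NatTrans.ext (funext fun Y => ?_))
    ext y : 1
    exact UnivCov.fibAct_mul hu hD σ τ y

/-- A point of a fibre is fixed by an open subgroup of `Gal_k`. -/
lemma UnivCov.exists_isOpen_fibAct_eq {u : D.UnivCov} (hu : u.LiesOver x)
    (hD : D.GSharp = ⊤) {Y : FEt X} (y : Fib x.hom Y) :
    ∃ U : Subgroup (GalK k), IsOpen (U : Set (GalK k)) ∧ ∀ σ ∈ U, u.fibAct hu σ y = y := by
  obtain ⟨i, h, hy⟩ := u.exists_map_eq hu y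
  refine ⟨MulAction.stabilizer (GalK k) (u.pt i).toPt, isOpen_stabilizer _ _, fun σ hσ => ?_⟩
  refine (u.fibAct_eq_iff hu hD).2 ⟨i, geomProj i ≫ h.hom.left, ?_, hy, ?_⟩
  · rw [Category.assoc, FEt.w]
    rfl
  -- An automorphism that fixes the point u_i of X_μ fixes α, so u has the same component at both
  -- indices.
  · have hi : σ • i = i := Index.ext rfl (heq_of_eq ((u.pt i).comp_emb_eq_of_smul_toPt_eq hσ))
    have e : (u.pt (σ • i)).toPt = ((u.pt i).toPt : Pt (M.str i.name)) :=
      eq_of_heq (u.toPt_pt_eq hi)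
    have e' : (u.pt (σ • i)).hom ≫ geomProj (σ • i) = (u.pt i).hom ≫ geomProj i :=
      congrArg Pt.hom e
    rw [← hy, ← Category.assoc (twist σ i), twist_proj]
    exact (Category.assoc _ _ _).symm.trans
      ((congrArg (· ≫ h.hom.left) e').trans (Category.assoc _ _ _))

-- The topology is induced from the product of the discrete automorphism groups of the fibres. Each
-- fibre is finite, so finitely many open subgroups intersect in an open one that acts trivially on
-- it, and each coordinate of the map is locally constant.
open scoped PreGaloisCategory in
lemma UnivCov.continuous_galToPiOne {u : D.UnivCov} (hu : u.LiesOver x) (hD : D.GSharp = ⊤) :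
    Continuous (u.galToPiOne hu hD) := by
  refine continuous_induced_rng.2 (continuous_pi fun Y => ?_)
  choose U hU hU' using fun y : Fib x.hom Y => u.exists_isOpen_fibAct_eq hu hD y
  let V : Subgroup (GalK k) := ⨅ y, U y
  have hV : IsOpen (V : Set (GalK k)) := by
    rw [Subgroup.coe_iInf]
    exact isOpen_iInter_of_finite hU
  refine continuous_iff_continuousAt.2 fun σ => ?_
  refine Filter.Tendsto.congr' (Filter.EventuallyEq.symm ?_) tendsto_const_nhds
  refine Filter.mem_of_superset ((hV.preimage (continuous_const_mul σ⁻¹)).mem_nhds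
    (by simp [V.one_mem])) fun τ hτ => ?_
  have hτ' : ∀ y, σ⁻¹ * τ ∈ U y := fun y => Subgroup.mem_iInf.1 hτ y
  refine Iso.ext ?_
  ext y : 1
  have h : ∀ y : Fib x.hom Y, u.fibAct hu τ y = u.fibAct hu σ y := fun y => by
    conv_lhs => rw [← mul_inv_cancel_left σ τ, UnivCov.fibAct_mul hu hD, hU' y _ (hτ' y)]
  exact h y

/-- A morphism X_μ → X ×_k L is given on constants by some ψ : L → k^μ. The image of u_i has
embedding α ∘ ψ; its translate is the image of u_{σ(i)}, which lies on X_{μ,σ(α)}, and has embedding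
σ ∘ α ∘ ψ. -/
lemma UnivCov.constEmb_fibAct {u : D.UnivCov} (hu : u.LiesOver x) (hD : D.GSharp = ⊤) (σ : GalK k)
    (L : IntermediateField k (AlgebraicClosure k)) [FiniteDimensional k L]
    (y : Fib x.hom (constCover s L)) : constEmb (u.fibAct hu σ y) =
      (σ : AlgebraicClosure k →ₐ[k] AlgebraicClosure k).comp (constEmb y) := by
  obtain ⟨i, h, hy⟩ := u.exists_map_eq hu y
  let y' : Fib x.hom (constCover s L) := ⟨(u.pt (σ • i)).hom ≫ geomProj (σ • i) ≫ h.hom.left, by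
    rw [Category.assoc, Category.assoc, FEt.w]
    exact hu (σ • i)⟩
  have hm : u.fibAct hu σ y = y' := by
    refine (u.fibAct_eq_iff hu hD).2 ⟨i, geomProj i ≫ h.hom.left, ?_, hy, ?_⟩
    · rw [Category.assoc, FEt.w]
      rfl
    · rw [← Category.assoc (twist σ i), twist_proj]
  obtain ⟨ψ, hψ⟩ := exists_toConst_factor (M.str i.name) (h.hom.left ≫ constProj s L) (by
    rw [Category.assoc, constProj_comp, ← Category.assoc, FEt.w]
    rfl)
  have key : ∀ (α : ConstFn (M.str i.name) →ₐ[k] AlgebraicClosure k)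
      (t : GeomPt (⟨i.name, α⟩ : M.Index)) (z : Fib x.hom (constCover s L)),
      t.hom ≫ geomProj _ ≫ h.hom.left = z.hom → constEmb z = α.comp ψ := by
    intro α t z hz
    refine algHom_eq_of_specHom_eq ?_
    have ht := t.emb_toPt
    change t.toPt.emb = α at ht
    rw [specHom_constEmb, ← hz, Category.assoc, Category.assoc, ← hψ, ← Category.assoc,
      ← GeomPt.toPt_hom, ← Category.assoc]
    refine (congrArg (· ≫ specHom (ψ : L →+* ConstFn (M.str i.name)))
      (Pt.specHom_emb t.toPt).symm).trans ?_
    rw [ht, ← Spec.map_comp]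
    rfl
  rw [hm, key i.emb (u.pt i) y hy]
  exact key ((σ : AlgebraicClosure k →ₐ[k] AlgebraicClosure k).comp i.emb) (u.pt (σ • i)) y' rfl

lemma UnivCov.toGal_galToPiOne {u : D.UnivCov} (hu : u.LiesOver x) (hD : D.GSharp = ⊤)
    (σ : GalK k) : PiOne.toGal x (u.galToPiOne hu hD σ) = σ := by
  refine AlgEquiv.ext fun a => ?_
  change constEmb (u.fibAct hu σ (constPt x _ (IntermediateField.val _)))
    (IntermediateField.AdjoinSimple.gen k a) = σ a
  rw [UnivCov.constEmb_fibAct hu hD, constEmb_constPt]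
  rfl

lemma UnivCov.fibAct_eval {u : D.UnivCov} (hu : u.LiesOver x) (hD : D.GSharp = ⊤) (σ : GalK k)
    {μ : M.Name} (q : D.PTilde μ) : u.fibAct hu σ (q.eval hu) =
      (AutEt.onPTilde (autEtOfGal hD σ) q).eval hu := by
  obtain ⟨q, α, g, hg, hq⟩ := q
  refine (u.fibAct_eq_iff hu hD).2 ⟨⟨μ, α⟩, g.hom ≫ geomProj ⟨μ, α⟩, ?_, ?_, ?_⟩
  · rw [Category.assoc]
    exact g.w_map
  · exact (Category.assoc _ _ _).symm.trans (congrArg Pt.hom (hq u)).symm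
  · refine Eq.trans ?_ (congrArg Pt.hom (hq.conjMap hD σ u)).symm
    rw [GeomPt.toPt_hom, GeomHom.app_hom, Category.assoc]
    exact congrArg _ (g.conj_proj σ).symm

end

end DistinguishedSystem

end GaloisSection

end UnivCover
end
open UnivCover UnivCover.DistinguishedSystem
theorem theorem7p1 {k : Type u} [Field k] [CharZero k] {X : Scheme.{u}}
    (s : X ⟶ Spec (CommRingCat.of k)) [Smooth s] [IsSeparated s] [QuasiCompact s]
    [GeometricallyConnected s] (M : CoverFamily.{u, w} s) (D : DistinguishedSystem M)
    (hk : D.kSharp = ⊥) :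
    (∀ τ : D.AutSharp, ∃! τ' : D.AutEt, Extends τ' τ) ∧
    Function.Bijective (AutSharp.toGal : D.AutSharp →* GalK k) ∧
    ∃ t : GalK k →* D.AutEt,
      (∀ σ, AutEt.toGal (t σ) = σ) ∧
      (∀ τ : D.AutSharp, Extends (t (AutSharp.toGal τ)) τ) ∧
      ∀ x : Pt s, (∃ u : D.UnivCov, u.LiesOver x) ∧
        ∀ (u : D.UnivCov) (hu : u.LiesOver x),
          ∃ f : GalK k →* PiOne x.hom,
            Continuous f ∧ (∀ σ, PiOne.toGal x (f σ) = σ) ∧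
            ∀ (σ : GalK k) (μ : M.Name) (q : D.PTilde μ),
              (f σ).act (q.eval hu) = (AutEt.onPTilde (t σ) q).eval hu := by
  have hD := D.gSharp_eq_top hk
  refine ⟨fun τ => ⟨autEtOfGal hD (AutSharp.toGal τ), extends_autEtOfGal hD τ,
    fun τ' h => h.unique (extends_autEtOfGal hD τ)⟩, AutSharp.bijective_toGal hD,
    autEtOfGal hD, fun σ => rfl, extends_autEtOfGal hD, fun x => ⟨exists_liesOver D x,
    fun u hu => ⟨u.galToPiOne hu hD, u.continuous_galToPiOne hu hD, u.toGal_galToPiOne hu hD,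
      fun σ μ q => u.fibAct_eval hu hD σ q⟩⟩⟩
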